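/- **Setting.** All algebras are unital associative algebras over $\mathbb C$. Let $D\subset B\subset M$ be unital subalgebras, and let $E:M\to B$ and $F:B\to D$ be conditional expectations, i.e. linear, unital maps with $E(bmb')=bE(m)b'$ for $b,b'\in B$, $m\in M$, and $F(dbd')=dF(b)d'$ for $d,d'\in D$, $b\in B$. Then $F\circ E:M\to D$ is a conditional expectation too. *Cumulants.* For $G=E$ or $G=F\circ E$, with values in $A=B$ or $A=D$ respectively, the cumulant maps $\{m_1,\dots,m_n\}_G\in A$ ($n\ge 1$, $m_i\in M$) are determined recursively by the moment-cumulant formula $$G(m_1\cdots m_n)=\sum_{\pi\in NC(n)}\pi\{m_1,\dots,m_n\}_G .$$ Here $NC(n)$ is the set of non-crossing partitions of $\{1,\dots,n\}$, and $\pi\{\cdots\}_G$ is the nested expression in which each block of $\pi$ is a bracket $\{\cdots\}_G$. Explicitly, if $v_1<\dots<v_r$ is the block of the first index, $G_j$ is the set of indices between $v_j$ and $v_{j+1}$, and $R$ is the set of indices to the right of $v_r$, then $$\pi\{m_1,\dots,m_n\}_G=\{m_{v_1}\cdot\pi|_{G_1}\{\cdots\}_G,\ \dots,\ m_{v_{r-1}}\cdot\pi|_{G_{r-1}}\{\cdots\}_G,\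 m_{v_r}\}_G\cdot\pi|_R\{\cdots\}_G ,$$ where the bracketing of no variables is $1$. For $X_1,\dots,X_n\in M$, $k\ge 1$ and $i_1,\dots,i_k\in\{1,\dots,n\}$, the $B$-valued and $D$-valued cumulant series are $$k_{B;i_1,\dots,i_k}(b_1,\dots,b_{k-1})=\{X_{i_1}b_1,\dots,X_{i_{k-1}}b_{k-1},X_{i_k}\}_E\quad(b_j\in B),$$ $$k_{D;i_1,\dots,i_k}(d_1,\dots,d_{k-1})=\{X_{i_1}d_1,\dots,X_{i_{k-1}}d_{k-1},X_{i_k}\}_{F\circ E}\quad(d_j\in D).$$ *Freeness.* A subalgebra $N$ with $D\subset N\subset M$ is free from $B$ with amalgamation over $D$ if $F(E(a_1\cdots a_s))=0$ whenever $s\ge 1$, $F(E(a_j))=0$ for all $j$, and the $a_j$ are taken alternately from $N$ and from $B$. Elements $X_1,\dots,X_n\in M$ are free from $B$ with amalgamation over $D$ if the algebra generated by $D$ and $X_1,\dots,X_n$ is. **Theorem.** Assume that $F$ is faithful in the following sense: if $b_1\in B$ and $F(b_1b_2)=0$ for all $b_2\in B$, then $b_1=0$. (1) Let $X_1,\dots,X_n\in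 M$. The following are equivalent: (a) $X_1,\dots,X_n$ are free from $B$ with amalgamation over $D$; (b) $k_{B;i_1,\dots,i_k}(b_1,\dots,b_{k-1})=F\big(k_{B;i_1,\dots,i_k}(F(b_1),\dots,F(b_{k-1}))\big)$ for all $k\ge 1$, all $i_1,\dots,i_k$ and all $b_1,\dots,b_{k-1}\in B$; (c) $k_{B;i_1,\dots,i_k}(b_1,\dots,b_{k-1})=k_{D;i_1,\dots,i_k}(F(b_1),\dots,F(b_{k-1}))$ for all $k\ge 1$, all $i_1,\dots,i_k$ and all $b_1,\dots,b_{k-1}\in B$. (2) Let $N\subset M$ be a subalgebra containing $D$. Then $N$ is free from $B$ with amalgamation over $D$ if and only if $$\{n_1b_1,\dots,n_{k-1}b_{k-1},n_k\}_E=F\big(\{n_1F(b_1),\dots,n_{k-1}F(b_{k-1}),n_k\}_E\big)$$ for all $k\ge 1$, all $n_1,\dots,n_k\in N$ and all $b_1,\dots,b_{k-1}\in B$. -/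

import Mathlib

/-- A conditional expectation `E : A → C` onto a unital subalgebra `ι : C → A`: a `ℂ`-linear map
that is unital and `C`-bilinear. -/
structure IsCondExp {A C : Type*} [Ring A] [Algebra ℂ A] [Ring C] [Algebra ℂ C]
    (ι : C →ₐ[ℂ] A) (E : A →ₗ[ℂ] C) : Prop where
  map_one : E 1 = 1
  map_bilinear : ∀ (c c' : C) (a : A), E (ι c * a * ι c') = c * E a * c'

/-- A partition of a finite set of natural numbers is non-crossing if there are no
`i < j < k < l` with `i, k` in one block and `j, l` in another block. -/
def IsNonCrossing {s : Finset ℕ} (π : Finpartition s) : Prop :=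
  ∀ U ∈ π.parts, ∀ V ∈ π.parts, ∀ i ∈ U, ∀ j ∈ V, ∀ k ∈ U, ∀ l ∈ V,
    i < j → j < k → k < l → U = V

open Classical in
/-- `NC(n)`, the set of non-crossing partitions of `{0, …, n - 1}`. -/
noncomputable def NCPart (n : ℕ) : Finset (Finpartition (Finset.range n)) :=
  Finset.univ.filter IsNonCrossing

/-- The points of `s` lying strictly between the element `w` of the block `V` and the next element
of `V` (if there is none: the points to the right of `w`). -/
def gapAfter (s V : Finset ℕ) (w : ℕ) : Finset ℕ :=
  s.filter fun x => w < x ∧ ∀ u ∈ V, w < u → x < u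

/-- The points of `s` lying to the right of all elements of the block `V`. -/
def gapRight (s V : Finset ℕ) : Finset ℕ :=
  s.filter fun x => ∀ u ∈ V, u < x

open Classical in
/-- The bracketing `π⟨…⟩` of the variables `m i`, `i ∈ s`, where `s` is a union of blocks of the
partition `π`. Let `V = {v₁ < ⋯ < vₖ}` be the block of the smallest element of `s`, let `Gⱼ` be
the part of `s` between `vⱼ` and `vⱼ₊₁` and `R` the part to the right of `vₖ`. Since `π` is
non-crossing, its restriction to `s` is the one-block partition `1ₖ` on `V`, with `π|Gⱼ` inserted
after `vⱼ`, followed by `π|R`; accordingly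
`π⟨m⟩ = ⟨m v₁ · (π|G₁)⟨m⟩, …, m vₖ₋₁ · (π|Gₖ₋₁)⟨m⟩, m vₖ⟩ · (π|R)⟨m⟩`,
where the bracketing of no variables is `1`. -/
noncomputable def bracketing {M : Type*} [Ring M] [Algebra ℂ M] {B : Subalgebra ℂ M} {t : Finset ℕ}
    (br : List M → B) (m : ℕ → M) (π : Finpartition t) (s : Finset ℕ) : B :=
  if h : s.Nonempty then
    br (((π.part (s.min' h)).sort (· ≤ ·)).map fun w =>
        if ∃ u ∈ π.part (s.min' h), w < u then
          m w * (bracketing br m π (gapAfter (s.erase (s.min' h)) (π.part (s.min' h)) w) : M)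
        else m w)
      * bracketing br m π (gapRight (s.erase (s.min' h)) (π.part (s.min' h)))
  else 1
termination_by s.card
decreasing_by
  · exact (Finset.card_le_card (Finset.filter_subset _ _)).trans_lt
      (Finset.card_erase_lt_of_mem (s.min'_mem h))
  · exact (Finset.card_le_card (Finset.filter_subset _ _)).trans_lt
      (Finset.card_erase_lt_of_mem (s.min'_mem h))

/-- The moment map `[m₁, …, mₙ]_E = E (m₁ ⋯ mₙ)`. -/
def momentMap {M : Type*} [Ring M] [Algebra ℂ M] {B : Subalgebra ℂ M} (E : M →ₗ[ℂ] B)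
    (l : List M) : B :=
  E l.prod

open Classical in
/-- The cumulant map (`R`-transform) `{m₁, …, mₙ}_E`, determined recursively by the
moment-cumulant formula `[m₁, …, mₙ]_E = ∑ π ∈ NC(n), π{m₁, …, mₙ}_E`: the summand of the
one-block partition is `{m₁, …, mₙ}_E`, all others involve only shorter brackets.
See `momentMap_eq_sum_bracketing`. -/
noncomputable def cumulantMap {M : Type*} [Ring M] [Algebra ℂ M] {B : Subalgebra ℂ M}
    (E : M →ₗ[ℂ] B) (l : List M) : B :=
  momentMap E l -
    ∑ π ∈ (NCPart l.length).filter (fun π => π.parts ≠ {Finset.range l.length}),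
      bracketing (fun l' => if _h : l'.length < l.length then cumulantMap E l' else 0)
        (fun i => l.getD i 0) π (Finset.range l.length)
termination_by l.length

/-- The cumulant series `k_{i₁, …, iₖ}(b₁, …, bₖ₋₁) = {X_{i₁} b₁, …, X_{iₖ₋₁} bₖ₋₁, X_{iₖ}}_E`
of a family `X`, with `k = p + 1`. -/
noncomputable def cumulantSeries {M : Type*} [Ring M] [Algebra ℂ M] {B : Subalgebra ℂ M}
    (E : M →ₗ[ℂ] B) {J : Type*} (X : J → M) {p : ℕ} (i : Fin (p + 1) → J) (b : Fin p → B) : B :=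
  cumulantMap E
    (List.ofFn (fun j : Fin p => X (i j.castSucc) * (b j : M)) ++ [X (i (Fin.last p))])

/-- Freeness of a family of subalgebras `A j` with amalgamation over `D`, with respect to
`φ : M → D`: alternating products of `φ`-centred elements are `φ`-centred. -/
def IsFreeOver {M : Type*} [Ring M] [Algebra ℂ M] {D : Subalgebra ℂ M} (φ : M →ₗ[ℂ] D)
    {J : Type*} (A : J → Subalgebra ℂ M) : Prop :=
  (∀ j, D ≤ A j) ∧
    ∀ (p : ℕ) (j : Fin (p + 1) → J) (a : Fin (p + 1) → M),
      (∀ r : Fin p, j r.castSucc ≠ j r.succ) → (∀ r, a r ∈ A (j r)) → (∀ r, φ (a r) = 0) →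
        φ (List.ofFn a).prod = 0

theorem bracketing_congr {M : Type*} [Ring M] [Algebra ℂ M] {B : Subalgebra ℂ M} {t : Finset ℕ}
    (br br' : List M → B) (m : ℕ → M) (π : Finpartition t)
    (h : ∀ (l : List M) (a : ℕ), l.length = (π.part a).card → br l = br' l) (s : Finset ℕ) :
    bracketing br m π s = bracketing br' m π s := by
  induction hs : s.card using Nat.strong_induction_on generalizing s with
  | _ c ih =>
    rw [bracketing, bracketing]
    split_ifs with hne
    · have key : ∀ p : ℕ → Prop, ∀ [DecidablePred p],
          bracketing br m π ((s.erase (s.min' hne)).filter p)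
            = bracketing br' m π ((s.erase (s.min' hne)).filter p) := by
        intro p _
        refine ih _ ?_ _ rfl
        rw [← hs]
        exact (Finset.card_le_card (Finset.filter_subset _ _)).trans_lt
          (Finset.card_erase_lt_of_mem (s.min'_mem hne))
      have k1 : ∀ w, bracketing br m π (gapAfter (s.erase (s.min' hne)) (π.part (s.min' hne)) w)
          = bracketing br' m π (gapAfter (s.erase (s.min' hne)) (π.part (s.min' hne)) w) :=
        fun w => key _
      have k2 : bracketing br m π (gapRight (s.erase (s.min' hne)) (π.part (s.min' hne)))
          = bracketing br' m π (gapRight (s.erase (s.min' hne)) (π.part (s.min' hne))) := key _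
      simp only [k1, k2]
      congr 1
      exact h _ (s.min' hne) (by simp)
    · rfl

/-- The moment-cumulant formula. -/
theorem momentMap_eq_sum_bracketing {M : Type*} [Ring M] [Algebra ℂ M] {B : Subalgebra ℂ M}
    (E : M →ₗ[ℂ] B) (l : List M) (hl : l ≠ []) :
    momentMap E l = ∑ π ∈ NCPart l.length,
      bracketing (cumulantMap E) (fun i => l.getD i 0) π (Finset.range l.length) := by
  classical
  have hpos : 0 < l.length := List.length_pos_iff.2 hl
  have hne : (Finset.range l.length).Nonempty := Finset.nonempty_range_iff.2 hpos.ne'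
  have hone : ∀ π : Finpartition (Finset.range l.length), π.parts = {Finset.range l.length} →
      bracketing (cumulantMap E) (fun i => l.getD i 0) π (Finset.range l.length)
        = cumulantMap E l := by
    intro π hπ
    have hmin : (Finset.range l.length).min' hne ∈ Finset.range l.length := Finset.min'_mem _ _
    have hpart : π.part ((Finset.range l.length).min' hne) = Finset.range l.length := by
      have := π.part_mem.2 hmin
      rwa [hπ, Finset.mem_singleton] at this
    have hgapR : gapRight ((Finset.range l.length).erase ((Finset.range l.length).min' hne))
        (Finset.range l.length) = ∅ := by
      refine Finset.filter_eq_empty_iff.2 fun x hx hx' => ?_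
      exact lt_irrefl _ (hx' x (Finset.mem_of_mem_erase hx))
    have hgapA : ∀ w, (∃ u ∈ Finset.range l.length, w < u) →
        gapAfter ((Finset.range l.length).erase ((Finset.range l.length).min' hne))
        (Finset.range l.length) w = ∅ := by
      intro w _
      refine Finset.filter_eq_empty_iff.2 fun x hx hx' => ?_
      exact lt_irrefl _ (hx'.2 x (Finset.mem_of_mem_erase hx) hx'.1)
    have hempty : bracketing (cumulantMap E) (fun i => l.getD i 0) π ∅ = 1 := by
      rw [bracketing, dif_neg Finset.not_nonempty_empty]
    rw [bracketing, dif_pos hne, hpart, hgapR, hempty, mul_one]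
    congr 1
    have hsort : (Finset.range l.length).sort (· ≤ ·) = List.range l.length :=
      Finset.sort_range l.length
    rw [hsort]
    refine List.ext_getElem (by simp) fun i h1 h2 => ?_
    rw [List.getElem_map]
    split_ifs with hu
    · rw [hgapA _ hu, hempty]
      simp [h2]
    · simp [h2]
  have hrest : ∀ π ∈ (NCPart l.length).filter (fun π => ¬ π.parts = {Finset.range l.length}),
      bracketing (fun l' => if _h : l'.length < l.length then cumulantMap E l' else 0)
        (fun i => l.getD i 0) π (Finset.range l.length) =
      bracketing (cumulantMap E) (fun i => l.getD i 0) π (Finset.range l.length) := by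
    intro π hπ
    refine bracketing_congr _ _ _ _ (fun l' a hla => ?_) _
    have hlt : l'.length < l.length := by
      rw [hla]
      by_cases ha : a ∈ Finset.range l.length
      · have hmem := π.part_mem.2 ha
        have hsub : π.part a ⊆ Finset.range l.length := π.le hmem
        rcases hsub.eq_or_ssubset with heq | hss
        · exfalso
          refine (Finset.mem_filter.1 hπ).2 (Finset.eq_singleton_iff_unique_mem.2
            ⟨Eq.subst (motive := fun x : Finset ℕ => x ∈ π.parts) heq hmem, fun U hU => ?_⟩)
          obtain ⟨x, hx⟩ := π.nonempty_of_mem_parts hU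
          have hxa : x ∈ π.part a := by rw [heq]; exact π.le hU hx
          exact (π.eq_of_mem_parts hU hmem hx hxa).trans heq
        · simpa using Finset.card_lt_card hss
      · have : π.part a = ∅ := by simp [ha]
        simpa [this] using hpos
    simp [hlt]
  rw [← Finset.sum_filter_add_sum_filter_not (NCPart l.length)
    (fun π => π.parts = {Finset.range l.length}), ← Finset.sum_congr rfl hrest]
  have hsingle : (NCPart l.length).filter (fun π => π.parts = {Finset.range l.length})
      = {Finpartition.indiscrete hne.ne_empty} := by
    ext π
    simp only [Finset.mem_filter, Finset.mem_singleton, NCPart, Finset.mem_univ, true_and]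
    constructor
    · rintro ⟨-, h⟩
      exact Finpartition.ext h
    · rintro rfl
      refine ⟨?_, rfl⟩
      intro U hU V hV
      rw [Finpartition.indiscrete_parts, Finset.mem_singleton] at hU hV
      intros
      rw [hU, hV]
  rw [hsingle, Finset.sum_singleton, hone _ rfl, cumulantMap]
  simp only [ne_eq]
  abel

/-! Two consequences of the moment-cumulant formula carry the proof. First, sort the non-crossing
partitions by the block of the first letter: the partitions of each gap of that block sum up to a
moment, so `E (a l₁ ⋯ lᵣ)` is the sum, over all blocks containing `a`, of one cumulant whose entries
are the chosen letters, each multiplied by `E` of the gap behind it (`moment_eq_blockSum`). The same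
recursion shows that cumulants are additive in every entry and right `B`-linear in the last one.
Second, cumulants with a product as an entry (`cumulantMap_product`): `{u, xy, v}` is the sum over
the non-crossing partitions of the letters `u, x, y, v` that become the one-block partition once `x`
and `y` are joined. These have one block, or two blocks of which one is nested next to the other. In
particular, cumulants of order at least two with an entry from `B` vanish.

Condition (b) is recast as `ScalarCumulants`: for two systems of coefficients with the same images
under `F`, the two cumulants are the same element of `D` times the respective last coefficient. This
form survives the insertion of an inner cumulant as a coefficient of an outer one, so by the product
formula it passes from `x`, `y` to `xy`, and hence from generators to the algebra that they generate
with `D` (`ScalarCumulants.adjoin`). This reduces (1) to statements about a subalgebra `N`.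

For such an `N`, faithfulness of `F` turns freeness into the vanishing of `E` itself on words `n₁ b₁
⋯ nₖ bₖ` with centred `nᵢ` and centred `bᵢ` for `i < k` (`isFreeOver_iff_centredMomentsVanish`). By
induction on the length, the moment of such a word is its cumulant. If cumulants see the `bᵢ` only
through `F`, a centred coefficient may be replaced by `0`, so the moment vanishes. Conversely, if
these moments vanish, split every entry and coefficient into a centred part and a part in `D`. A
`D`-valued coefficient is absorbed into `N`, and the product formula then reduces to shorter
cumulants; the totally centred remainder is a vanishing moment. So each coefficient may be replaced
by its image under `F` (`CentredMomentsVanish.scalarCumulants`).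

For (c), `E` and `F ∘ E` agree on `N` once the cumulants are scalar, and the recursion then forces
their cumulants to agree on `N` (`cumulantMap_eq_of_scalar`). -/

/-! ### Brackets and sums over non-crossing partitions -/

/-- A bracket that is additive in every entry and right `B`-linear in the last entry. -/
structure IsAdditiveBracket {M : Type*} [Ring M] [Algebra ℂ M] {B : Subalgebra ℂ M}
    (br : List M → B) : Prop where
  add : ∀ (u : List M) (x y : M) (v : List M),
    br (u ++ (x + y) :: v) = br (u ++ x :: v) + br (u ++ y :: v)
  mul_right : ∀ (u : List M) (x : M) (b : B), br (u ++ [x * (b : M)]) = br (u ++ [x]) * b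

open Classical in
/-- The non-crossing partitions of a finite set of natural numbers. -/
noncomputable def ncPartitions (s : Finset ℕ) : Finset (Finpartition s) :=
  Finset.univ.filter IsNonCrossing

theorem mem_ncPartitions {s : Finset ℕ} {π : Finpartition s} :
    π ∈ ncPartitions s ↔ IsNonCrossing π := by
  simp [ncPartitions]

/-- The sum of the bracketings over all non-crossing partitions of `s`. -/
noncomputable def ncSum {M : Type*} [Ring M] [Algebra ℂ M] {B : Subalgebra ℂ M}
    (br : List M → B) (m : ℕ → M) (s : Finset ℕ) : B :=
  ∑ π ∈ ncPartitions s, bracketing br m π s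

theorem bracketing_of_part_eq {M : Type*} [Ring M] [Algebra ℂ M] {B : Subalgebra ℂ M}
    (br : List M → B) (m : ℕ → M) {t t' : Finset ℕ} (π : Finpartition t) (π' : Finpartition t')
    (s : Finset ℕ) (h : ∀ a ∈ s, π.part a = π'.part a) :
    bracketing br m π s = bracketing br m π' s := by
  induction hs : s.card using Nat.strong_induction_on generalizing s with
  | _ c ih =>
    rw [bracketing, bracketing]
    split_ifs with hne
    · have key : ∀ p : ℕ → Prop, ∀ [DecidablePred p],
          bracketing br m π ((s.erase (s.min' hne)).filter p)
            = bracketing br m π' ((s.erase (s.min' hne)).filter p) := by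
        intro p _
        refine ih _ ?_ _ (fun a ha => h a ?_) rfl
        · rw [← hs]
          exact (Finset.card_le_card (Finset.filter_subset _ _)).trans_lt
            (Finset.card_erase_lt_of_mem (s.min'_mem hne))
        · exact Finset.mem_of_mem_erase (Finset.mem_of_mem_filter _ ha)
      have hp := h _ (s.min'_mem hne)
      have k1 : ∀ w, bracketing br m π (gapAfter (s.erase (s.min' hne)) (π.part (s.min' hne)) w)
          = bracketing br m π' (gapAfter (s.erase (s.min' hne)) (π.part (s.min' hne)) w) :=
        fun w => key _
      have k2 : bracketing br m π (gapRight (s.erase (s.min' hne)) (π.part (s.min' hne)))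
          = bracketing br m π' (gapRight (s.erase (s.min' hne)) (π.part (s.min' hne))) := key _
      simp only [k1, k2]
      rw [hp]
    · rfl

theorem bracketing_empty {M : Type*} [Ring M] [Algebra ℂ M] {B : Subalgebra ℂ M}
    (br : List M → B) (m : ℕ → M) {t : Finset ℕ} (π : Finpartition t) :
    bracketing br m π ∅ = 1 := by
  rw [bracketing, dif_neg Finset.not_nonempty_empty]

theorem mem_gapAfter {s V : Finset ℕ} {w x : ℕ} :
    x ∈ gapAfter s V w ↔ x ∈ s ∧ w < x ∧ ∀ u ∈ V, w < u → x < u := by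
  simp [gapAfter]

theorem exists_sort_eq_concat {V : Finset ℕ} (hV : V.Nonempty) :
    ∃ (l : List ℕ) (z : ℕ), V.sort (· ≤ ·) = l ++ [z] ∧ z ∈ V ∧ (∀ u ∈ V, u ≤ z) ∧
      ∀ w ∈ l, w < z := by
  rcases List.eq_nil_or_concat (V.sort (· ≤ ·)) with h | ⟨l, z, h⟩
  · obtain ⟨x, hx⟩ := hV
    rw [← Finset.mem_sort (· ≤ ·), h] at hx
    simp at hx
  · rw [List.concat_eq_append] at h
    have hlt : ∀ w ∈ l, w < z := by
      have := (Finset.sortedLT_sort V).pairwise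
      rw [h, List.pairwise_append] at this
      intro w hw
      exact this.2.2 w hw z (by simp)
    refine ⟨l, z, h, ?_, ?_, hlt⟩
    · rw [← Finset.mem_sort (· ≤ ·), h]; simp
    · intro u hu
      rw [← Finset.mem_sort (· ≤ ·), h] at hu
      rcases List.mem_append.1 hu with hu | hu
      · exact (hlt u hu).le
      · simp at hu; exact hu.le

/-- Right `B`-linearity moves the factor to the right of the block into its last entry, so that the
last element gets a gap like every other one and the formula becomes uniform. -/
theorem bracketing_eq {M : Type*} [Ring M] [Algebra ℂ M] {B : Subalgebra ℂ M}
    {br : List M → B} (hbr : IsAdditiveBracket br) (m : ℕ → M) {t : Finset ℕ}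
    (π : Finpartition t) {s V : Finset ℕ} (hs : s.Nonempty) (hV : π.part (s.min' hs) = V)
    (hVs : V ⊆ s) (hmem : s.min' hs ∈ V) :
    bracketing br m π s =
      br ((V.sort (· ≤ ·)).map fun w => m w * (bracketing br m π (gapAfter s V w) : M)) := by
  obtain ⟨l, z, hl, hz, hmax, hlt⟩ := exists_sort_eq_concat ⟨_, hmem⟩
  have hgap : ∀ w ∈ V, gapAfter (s.erase (s.min' hs)) V w = gapAfter s V w := by
    intro w hw
    ext x
    simp only [mem_gapAfter, Finset.mem_erase]
    have := s.min'_le w (hVs hw)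
    constructor
    · rintro ⟨h1, h2⟩; exact ⟨h1.2, h2⟩
    · rintro ⟨h1, h2⟩; exact ⟨⟨by omega, h1⟩, h2⟩
  have hright : gapRight (s.erase (s.min' hs)) V = gapAfter s V z := by
    rw [← hgap z hz]
    ext x
    simp only [mem_gapAfter, gapRight, Finset.mem_filter]
    refine and_congr_right fun _ => ⟨fun h => ⟨h z hz, fun u hu hzu => ?_⟩, fun h u hu => ?_⟩
    · exact absurd hzu (not_lt.2 (hmax u hu))
    · exact (hmax u hu).trans_lt h.1
  have hlV : ∀ w ∈ l, w ∈ V := by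
    intro w hw
    rw [← Finset.mem_sort (· ≤ ·), hl]; simp [hw]
  rw [bracketing, dif_pos hs]
  simp only [hV]
  rw [hl, hright, List.map_append, List.map_append, List.map_singleton, List.map_singleton,
    hbr.mul_right]
  congr 3
  · refine List.map_congr_left fun w hw => ?_
    rw [if_pos ⟨z, hz, hlt w hw⟩, hgap w (hlV w hw)]
  · rw [if_neg]
    rintro ⟨u, hu, hzu⟩
    exact absurd hzu (not_lt.2 (hmax u hu))

/-! ### Non-crossing partitions as a first block together with partitions of its gaps -/

section Gaps

variable {s V : Finset ℕ}

theorem gapAfter_subset (w : ℕ) : gapAfter s V w ⊆ s := Finset.filter_subset _ _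

theorem notMem_of_mem_gapAfter {w x : ℕ} (h : x ∈ gapAfter s V w) : x ∉ V := fun hx =>
  lt_irrefl _ ((mem_gapAfter.1 h).2.2 x hx (mem_gapAfter.1 h).2.1)

theorem gapAfter_index_unique {w w' x : ℕ} (hw : w ∈ V) (hw' : w' ∈ V) (h : x ∈ gapAfter s V w)
    (h' : x ∈ gapAfter s V w') : w = w' := by
  rw [mem_gapAfter] at h h'
  by_contra hne
  rcases lt_or_gt_of_ne hne with hlt | hlt
  · have := h.2.2 w' hw' hlt; omega
  · have := h'.2.2 w hw hlt; omega

theorem exists_mem_gapAfter {a x : ℕ} (ha : a ∈ V) (hx : x ∈ s) (hax : a < x) (hxV : x ∉ V) :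
    ∃ w ∈ V, x ∈ gapAfter s V w := by
  have hne : (V.filter (· < x)).Nonempty := ⟨a, by simp [ha, hax]⟩
  have hm := Finset.max'_mem _ hne
  rw [Finset.mem_filter] at hm
  refine ⟨_, hm.1, mem_gapAfter.2 ⟨hx, hm.2, fun u hu hlt => ?_⟩⟩
  by_contra hux
  have : u ≠ x := fun h => hxV (h ▸ hu)
  have := Finset.le_max' (V.filter (· < x)) u (by simp [hu]; omega)
  omega

/-- A block meeting two different gaps of `V` would cross `V`. Since `V` contains the minimum of
`s`, every point outside `V` does lie in some gap. -/
theorem IsNonCrossing.subset_gapAfter {π : Finpartition s} (hπ : IsNonCrossing π) {a : ℕ}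
    (hV : V ∈ π.parts) (ha : a ∈ V) (hmin : ∀ x ∈ s, a ≤ x) {U : Finset ℕ} (hU : U ∈ π.parts)
    {w x : ℕ} (hw : w ∈ V) (hx : x ∈ U) (hxw : x ∈ gapAfter s V w) : U ⊆ gapAfter s V w := by
  have hUV : V ≠ U := fun h => notMem_of_mem_gapAfter hxw (h ▸ hx)
  intro y hy
  have hyV : y ∉ V := fun h => hUV (π.eq_of_mem_parts hV hU h hy)
  have hys := π.subset hU hy
  have hay : a < y := lt_of_le_of_ne (hmin y hys) (fun h => hyV (h ▸ ha))
  obtain ⟨w', hw', hyw'⟩ := exists_mem_gapAfter ha hys hay hyV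
  rcases lt_trichotomy w w' with h | h | h
  · have h1 := mem_gapAfter.1 hxw
    have h2 := mem_gapAfter.1 hyw'
    exact absurd (hπ V hV U hU w hw x hx w' hw' y hy h1.2.1 (h1.2.2 w' hw' h) h2.2.1) hUV
  · rwa [h]
  · have h1 := mem_gapAfter.1 hxw
    have h2 := mem_gapAfter.1 hyw'
    exact absurd (hπ V hV U hU w' hw' y hy w hw x hx h2.2.1 (h2.2.2 w hw h) h1.2.1) hUV

/-- The restriction of a non-crossing partition to a gap of one of its blocks. -/
def gapRestrict (π : Finpartition s) (w : ℕ) : Finpartition (gapAfter s V w) :=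
  π.restrict (gapAfter_subset w)

/-- No block is cut by the restriction to a gap, so the intersections with the gap are either empty
or whole blocks. -/
theorem mem_parts_gapRestrict {π : Finpartition s} (hπ : IsNonCrossing π) {a : ℕ}
    (hV : V ∈ π.parts) (ha : a ∈ V) (hmin : ∀ x ∈ s, a ≤ x) {w : ℕ} (hw : w ∈ V)
    {U : Finset ℕ} : U ∈ (gapRestrict (V := V) π w).parts ↔ U ∈ π.parts ∧ U ⊆ gapAfter s V w := by
  simp only [gapRestrict, Finpartition.restrict, Finset.mem_erase, Finset.mem_image,
    Finset.bot_eq_empty, Finset.inf_eq_inter]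
  constructor
  · rintro ⟨hne, U', hU', rfl⟩
    obtain ⟨x, hx⟩ := Finset.nonempty_iff_ne_empty.2 hne
    rw [Finset.mem_inter] at hx
    have := hπ.subset_gapAfter hV ha hmin hU' hw hx.1 hx.2
    rw [Finset.inter_eq_left.2 this]
    exact ⟨hU', this⟩
  · rintro ⟨h1, h2⟩
    exact ⟨π.ne_empty h1, U, h1, Finset.inter_eq_left.2 h2⟩

open Classical in
/-- The partition of `s` with block `V` and given partitions of the gaps of `V`. -/
noncomputable def glue {a : ℕ} (hVs : V ⊆ s) (ha : a ∈ V) (hmin : ∀ x ∈ s, a ≤ x)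
    (ρ : ∀ w : V, Finpartition (gapAfter s V w)) : Finpartition s :=
  Finpartition.ofExistsUnique (insert V (Finset.univ.biUnion fun w => (ρ w).parts))
    (by
      intro p hp
      rw [Finset.mem_insert, Finset.mem_biUnion] at hp
      rcases hp with rfl | ⟨w, -, hp⟩
      · exact hVs
      · exact ((ρ w).subset hp).trans (gapAfter_subset _))
    (by
      intro x hx
      by_cases hxV : x ∈ V
      · refine ⟨V, by simp [hxV], ?_⟩
        rintro p ⟨hp, hxp⟩
        rw [Finset.mem_insert, Finset.mem_biUnion] at hp
        rcases hp with rfl | ⟨w, -, hp⟩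
        · rfl
        · exact absurd hxV (notMem_of_mem_gapAfter ((ρ w).subset hp hxp))
      · have hax : a < x := lt_of_le_of_ne (hmin x hx) (fun h => hxV (h ▸ ha))
        obtain ⟨w, hw, hxw⟩ := exists_mem_gapAfter ha hx hax hxV
        obtain ⟨p, ⟨hp, hxp⟩, -⟩ := (ρ ⟨w, hw⟩).existsUnique_mem hxw
        refine ⟨p, ⟨Finset.mem_insert_of_mem
          (Finset.mem_biUnion.2 ⟨⟨w, hw⟩, Finset.mem_univ _, hp⟩), hxp⟩, ?_⟩
        rintro q ⟨hq, hxq⟩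
        rw [Finset.mem_insert, Finset.mem_biUnion] at hq
        rcases hq with rfl | ⟨w', -, hq⟩
        · exact absurd hxq hxV
        · have hww : w = w' :=
            gapAfter_index_unique hw w'.2 hxw ((ρ w').subset hq hxq)
          obtain rfl : w' = ⟨w, hw⟩ := Subtype.ext hww.symm
          exact (ρ ⟨w, hw⟩).eq_of_mem_parts hq hp hxq hxp)
    (by
      intro h
      rw [Finset.mem_insert, Finset.mem_biUnion] at h
      rcases h with h | ⟨w, -, h⟩
      · rw [← h] at ha; simp at ha
      · exact (ρ w).empty_notMem_parts h)

theorem mem_parts_glue {a : ℕ} (hVs : V ⊆ s) (ha : a ∈ V) (hmin : ∀ x ∈ s, a ≤ x)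
    (ρ : ∀ w : V, Finpartition (gapAfter s V w)) {U : Finset ℕ} :
    U ∈ (glue hVs ha hmin ρ).parts ↔ U = V ∨ ∃ w, U ∈ (ρ w).parts := by
  simp [glue, Finpartition.ofExistsUnique]

theorem isNonCrossing_glue {a : ℕ} (hVs : V ⊆ s) (ha : a ∈ V) (hmin : ∀ x ∈ s, a ≤ x)
    (ρ : ∀ w : V, Finpartition (gapAfter s V w)) (hρ : ∀ w, IsNonCrossing (ρ w)) :
    IsNonCrossing (glue hVs ha hmin ρ) := by
  intro U hU U' hU' i hi j hj k hk l hl hij hjk hkl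
  rw [mem_parts_glue] at hU hU'
  rcases hU with rfl | ⟨w, hU⟩ <;> rcases hU' with rfl | ⟨w', hU'⟩
  · rfl
  · have h1 := mem_gapAfter.1 ((ρ w').subset hU' hj)
    have h2 := mem_gapAfter.1 ((ρ w').subset hU' hl)
    have := h2.2.2 k hk (h1.2.1.trans hjk)
    omega
  · have h1 := mem_gapAfter.1 ((ρ w).subset hU hi)
    have h2 := mem_gapAfter.1 ((ρ w).subset hU hk)
    have := h2.2.2 j hj (h1.2.1.trans hij)
    omega
  · have hi' := mem_gapAfter.1 ((ρ w).subset hU hi)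
    have hk' := mem_gapAfter.1 ((ρ w).subset hU hk)
    have hj' := mem_gapAfter.1 ((ρ w').subset hU' hj)
    have hl' := mem_gapAfter.1 ((ρ w').subset hU' hl)
    rcases lt_trichotomy (w : ℕ) w' with h | h | h
    · have := hk'.2.2 w' w'.2 h
      omega
    · obtain rfl : w = w' := Subtype.ext h
      exact hρ w U hU U' hU' i hi j hj k hk l hl hij hjk hkl
    · have := hj'.2.2 w w.2 h
      omega

end Gaps

/-- The multilinear map of the entries of the first block. -/
noncomputable def blockMultilinear {M : Type*} [Ring M] [Algebra ℂ M] {B : Subalgebra ℂ M}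
    {br : List M → B} (hbr : IsAdditiveBracket br) (m : ℕ → M) (V : Finset ℕ) :
    MultilinearMap ℕ (fun _ : V => B) B :=
  have hadd : ∀ [DecidableEq V] (g : V → B) (i : V) (x y : B),
      br ((V.attach.sort (· ≤ ·)).map fun w : V => m w * (Function.update g i (x + y) w : M)) =
      br ((V.attach.sort (· ≤ ·)).map fun w : V => m w * (Function.update g i x w : M)) +
      br ((V.attach.sort (· ≤ ·)).map fun w : V => m w * (Function.update g i y w : M)) := by
    intro _ g i x y
    have hi : i ∈ V.attach.sort (· ≤ ·) := by simp
    obtain ⟨l₁, l₂, hl⟩ := List.append_of_mem hi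
    have hnd := V.attach.sort_nodup (· ≤ ·)
    rw [hl, List.nodup_append] at hnd
    have h1 : ∀ z : B, l₁.map (fun w : V => m w * (Function.update g i z w : M))
        = l₁.map fun w : V => m w * (g w : M) := fun z => List.map_congr_left fun w hw => by
      rw [Function.update_of_ne (hnd.2.2 w hw i (by simp))]
    have h2 : ∀ z : B, l₂.map (fun w : V => m w * (Function.update g i z w : M))
        = l₂.map fun w : V => m w * (g w : M) := fun z => List.map_congr_left fun w hw => by
      rw [Function.update_of_ne]
      rintro rfl
      exact (List.nodup_cons.1 hnd.2.1).1 hw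
    rw [hl]
    simp only [List.map_append, List.map_cons, h1, h2, Function.update_self]
    rw [← hbr.add]
    simp [mul_add]
  { toFun := fun g => br ((V.attach.sort (· ≤ ·)).map fun w : V => m w * (g w : M))
    map_update_add' := fun g i x y => hadd g i x y
    -- Scalars are natural numbers: additivity alone makes the map `ℕ`-multilinear, which suffices
    -- to distribute over finite sums.
    map_update_smul' := fun g i c x =>
      map_nsmul (AddMonoidHom.mk' (fun x => br ((V.attach.sort (· ≤ ·)).map fun w : V =>
        m w * (Function.update g i x w : M))) (hadd g i)) c x }

theorem map_attach_sort {α : Type*} (V : Finset ℕ) (f : ℕ → α) :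
    (V.attach.sort (· ≤ ·)).map (fun w : V => f w) = (V.sort (· ≤ ·)).map f := by
  have : (V.attach.sort (· ≤ ·)).map (fun w : V => (w : ℕ)) = V.sort (· ≤ ·) := by
    refine List.SortedLT.eq_of_mem_iff ?_ (Finset.sortedLT_sort V) (by simp)
    exact (((Finset.sortedLT_sort V.attach).pairwise).map (fun w : V => (w : ℕ)) (fun _ _ h => h)).sortedLT
  rw [← this, List.map_map]
  rfl

/-- Splitting off the first block in a sum over non-crossing partitions. -/
theorem ncSum_eq {M : Type*} [Ring M] [Algebra ℂ M] {B : Subalgebra ℂ M}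
    {br : List M → B} (hbr : IsAdditiveBracket br) (m : ℕ → M) {s : Finset ℕ} {a : ℕ}
    (has : a ∈ s) (hmin : ∀ x ∈ s, a ≤ x) :
    ncSum br m s = ∑ V ∈ s.powerset.filter (a ∈ ·),
      br ((V.sort (· ≤ ·)).map fun w => m w * (ncSum br m (gapAfter s V w) : M)) := by
  classical
  have hmin' : s.min' ⟨a, has⟩ = a := le_antisymm (s.min'_le a has) (hmin _ (s.min'_mem _))
  rw [ncSum, ← Finset.sum_fiberwise_of_maps_to (t := s.powerset.filter (a ∈ ·))
    (g := fun π : Finpartition s => π.part a)]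
  swap
  · intro π _
    simp [π.part_subset, has]
  refine Finset.sum_congr rfl fun V hV => ?_
  rw [Finset.mem_filter, Finset.mem_powerset] at hV
  obtain ⟨hVs, haV⟩ := hV
  rw [← map_attach_sort V fun w => m w * (ncSum br m (gapAfter s V w) : M)]
  -- Expanding a bracket whose entries contain sums over the gaps gives a sum over families of
  -- partitions, one for each gap; these families correspond to the partitions with first block `V`.
  have := (blockMultilinear hbr m V).map_sum_finset
    (α := fun w : V => Finpartition (gapAfter s V w))
    (fun w π => bracketing br m π (gapAfter s V w)) (fun w => ncPartitions (gapAfter s V w))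
  refine Eq.trans ?_ this.symm
  refine Finset.sum_bij (fun π _ w => gapRestrict π w) ?_ ?_ ?_ ?_
  · intro π hπ
    rw [Finset.mem_filter, mem_ncPartitions] at hπ
    have hVp : V ∈ π.parts := hπ.2 ▸ π.part_mem.2 has
    rw [Fintype.mem_piFinset]
    intro w
    rw [mem_ncPartitions]
    intro U hU U' hU'
    rw [mem_parts_gapRestrict hπ.1 hVp haV hmin w.2] at hU hU'
    exact hπ.1 U hU.1 U' hU'.1
  · have main : ∀ π π' : Finpartition s, IsNonCrossing π → IsNonCrossing π' → V ∈ π.parts →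
        V ∈ π'.parts → (∀ w : V, gapRestrict (V := V) π w = gapRestrict π' w) →
        π.parts ⊆ π'.parts := by
      intro π π' hπ hπ' hV hV' h U hU
      by_cases hUV : U = V
      · rwa [hUV]
      obtain ⟨x, hx⟩ := π.nonempty_of_mem_parts hU
      have hxV : x ∉ V := fun h => hUV (π.eq_of_mem_parts hU hV hx h)
      have hxs := π.subset hU hx
      obtain ⟨w, hw, hxw⟩ := exists_mem_gapAfter haV hxs
        (lt_of_le_of_ne (hmin x hxs) (fun h => hxV (h ▸ haV))) hxV
      have h1 : U ∈ (gapRestrict (V := V) π w).parts :=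
        (mem_parts_gapRestrict hπ hV haV hmin hw).2
          ⟨hU, hπ.subset_gapAfter hV haV hmin hU hw hx hxw⟩
      rw [h ⟨w, hw⟩, mem_parts_gapRestrict hπ' hV' haV hmin hw] at h1
      exact h1.1
    intro π hπ π' hπ' h
    rw [Finset.mem_filter, mem_ncPartitions] at hπ hπ'
    have hV : V ∈ π.parts := hπ.2 ▸ π.part_mem.2 has
    have hV' : V ∈ π'.parts := hπ'.2 ▸ π'.part_mem.2 has
    exact Finpartition.ext ((main π π' hπ.1 hπ'.1 hV hV' (fun w => congrFun h w)).antisymm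
      (main π' π hπ'.1 hπ.1 hV' hV (fun w => (congrFun h w).symm)))
  · intro ρ hρ
    rw [Fintype.mem_piFinset] at hρ
    have hnc := isNonCrossing_glue hVs haV hmin ρ (fun w => mem_ncPartitions.1 (hρ w))
    have hVp : V ∈ (glue hVs haV hmin ρ).parts := (mem_parts_glue ..).2 (Or.inl rfl)
    refine ⟨glue hVs haV hmin ρ, ?_, ?_⟩
    · rw [Finset.mem_filter, mem_ncPartitions]
      exact ⟨hnc, Finpartition.part_eq_of_mem _ hVp haV⟩
    · funext w
      refine Finpartition.ext ?_
      ext U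
      rw [mem_parts_gapRestrict hnc hVp haV hmin w.2, mem_parts_glue]
      constructor
      · rintro ⟨rfl | ⟨w', hU⟩, h⟩
        · exact absurd haV (notMem_of_mem_gapAfter (h haV))
        · obtain ⟨x, hx⟩ := (ρ w').nonempty_of_mem_parts hU
          obtain rfl : w' = w :=
            Subtype.ext (gapAfter_index_unique w'.2 w.2 ((ρ w').subset hU hx) (h hx))
          exact hU
      · intro hU
        exact ⟨Or.inr ⟨w, hU⟩, (ρ w).subset hU⟩
  · intro π hπ
    rw [Finset.mem_filter, mem_ncPartitions] at hπ
    have hV : V ∈ π.parts := hπ.2 ▸ π.part_mem.2 has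
    rw [bracketing_eq hbr m π ⟨a, has⟩ (by rw [hmin']; exact hπ.2) hVs (by rw [hmin']; exact haV),
      ← map_attach_sort V fun w => m w * (bracketing br m π (gapAfter s V w) : M)]
    refine congrArg br (List.map_congr_left fun w _ => ?_)
    congr 2
    refine bracketing_of_part_eq br m _ _ _ fun x hx => ?_
    refine ((gapRestrict (V := V) π w).part_eq_of_mem
      ((mem_parts_gapRestrict hπ.1 hV haV hmin w.2).2 ⟨?_, ?_⟩) ?_).symm
    · exact π.part_mem.2 (gapAfter_subset _ hx)
    · exact hπ.1.subset_gapAfter hV haV hmin (π.part_mem.2 (gapAfter_subset _ hx)) w.2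
        (π.mem_part_self.2 (gapAfter_subset _ hx)) hx
    · exact π.mem_part_self.2 (gapAfter_subset _ hx)

/-! ### Module properties of conditional expectations -/

theorem IsCondExp.map_mul_right {M : Type*} [Ring M] [Algebra ℂ M] {B : Subalgebra ℂ M}
    {E : M →ₗ[ℂ] B} (hE : IsCondExp B.val E) (x : M) (b : B) : E (x * (b : M)) = E x * b := by
  simpa using hE.map_bilinear 1 b x

theorem IsCondExp.map_mul_left {M : Type*} [Ring M] [Algebra ℂ M] {B : Subalgebra ℂ M}
    {E : M →ₗ[ℂ] B} (hE : IsCondExp B.val E) (b : B) (x : M) : E ((b : M) * x) = b * E x := by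
  simpa using hE.map_bilinear b 1 x

theorem IsCondExp.map_coe {M : Type*} [Ring M] [Algebra ℂ M] {B : Subalgebra ℂ M}
    {E : M →ₗ[ℂ] B} (hE : IsCondExp B.val E) (b : B) : E (b : M) = b := by
  simpa [hE.map_one] using hE.map_mul_right 1 b

/-! ### Moments as sums over the block of the first letter -/

section BlockSum

variable {M : Type*} [Ring M] [Algebra ℂ M] {B : Subalgebra ℂ M}

/-- The sum over all ways to choose, among the letters `l`, the remaining elements of a block whose
entries so far are `p` (closed) and `a` (last element), with `y` the product of the letters since
`a` that were not chosen. -/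
def blockSum (E : M →ₗ[ℂ] B) (k : List M → M → M → B) : List M → M → M → List M → B
  | p, a, y, [] => k p a y
  | p, a, y, x :: l => blockSum E k p a (y * x) l + blockSum E k (p ++ [a * (E y : M)]) x 1 l

/-- Closing a block: the product `y` of the letters after its last element `a` is integrated. -/
def closeBlock (E : M →ₗ[ℂ] B) (κ : List M → B) (p : List M) (a y : M) : B :=
  κ (p ++ [a * (E y : M)])

/-- Additivity of a kernel in all its entries. -/
structure IsAdditiveKernel (k : List M → M → M → B) : Prop where
  add_closed : ∀ (u : List M) (x y : M) (v : List M) (a h : M),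
    k (u ++ (x + y) :: v) a h = k (u ++ x :: v) a h + k (u ++ y :: v) a h
  add_last : ∀ (p : List M) (x y h : M), k p (x + y) h = k p x h + k p y h
  add_gap : ∀ (p : List M) (a x y : M), k p a (x + y) = k p a x + k p a y

variable (E : M →ₗ[ℂ] B)

theorem blockSum_append (k : List M → M → M → B) (p : List M) (a y : M) (l l' : List M) :
    blockSum E k p a y (l ++ l') =
      blockSum E (fun p a y => blockSum E k p a y l') p a y l := by
  induction l generalizing p a y with
  | nil => rfl
  | cons x l ih => simp only [List.cons_append, blockSum, ih]

theorem blockSum_add (k k' : List M → M → M → B) (p : List M) (a y : M) (l : List M) :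
    blockSum E (fun p a y => k p a y + k' p a y) p a y l =
      blockSum E k p a y l + blockSum E k' p a y l := by
  induction l generalizing p a y with
  | nil => rfl
  | cons x l ih => simp only [blockSum, ih]; abel

theorem blockSum_sub (k k' : List M → M → M → B) (p : List M) (a y : M) (l : List M) :
    blockSum E (fun p a y => k p a y - k' p a y) p a y l =
      blockSum E k p a y l - blockSum E k' p a y l := by
  induction l generalizing p a y with
  | nil => rfl
  | cons x l ih => simp only [blockSum, ih]; abel

theorem map_blockSum (k : List M → M → M → B) (φ : B → B) (hφ : ∀ x y, φ (x + y) = φ x + φ y)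
    (p : List M) (a y : M) (l : List M) :
    φ (blockSum E k p a y l) = blockSum E (fun p a y => φ (k p a y)) p a y l := by
  induction l generalizing p a y with
  | nil => rfl
  | cons x l ih => simp only [blockSum, hφ, ih]

theorem blockSum_prefix (k : List M → M → M → B) (p₀ p : List M) (a y : M) (l : List M) :
    blockSum E k (p₀ ++ p) a y l = blockSum E (fun p a y => k (p₀ ++ p) a y) p a y l := by
  induction l generalizing p a y with
  | nil => rfl
  | cons x l ih => simp only [blockSum, List.append_assoc, ih]

theorem blockSum_eq_zero_of_length (k : List M → M → M → B) (p : List M) (a y : M) (l : List M)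
    (h : ∀ q b z, q.length ≤ p.length + l.length → k q b z = 0) :
    blockSum E k p a y l = 0 := by
  induction l generalizing p a y with
  | nil => exact h p a y (by simp)
  | cons x l ih =>
    rw [blockSum, ih, ih, add_zero]
    · intro q b z hq
      refine h q b z (hq.trans ?_)
      simp; omega
    · intro q b z hq
      refine h q b z (hq.trans ?_)
      simp

/-- Every letter left out shortens the resulting list, so a kernel vanishing on shorter lists sees
only the choice of all letters. There all gaps are empty and `E 1 = 1`. This isolates the top
cumulant in every later induction. -/
theorem blockSum_eq_full {E : M →ₗ[ℂ] B} (hE : IsCondExp B.val E) (k : List M → M → M → B)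
    (p : List M) (a : M) (l : List M)
    (h : ∀ q b z, q.length < p.length + l.length → k q b z = 0) :
    ∃ u z, a :: l = u ++ [z] ∧ blockSum E k p a 1 l = k (p ++ u) z 1 := by
  induction l generalizing p a with
  | nil => exact ⟨[], a, rfl, by simp [blockSum]⟩
  | cons x l ih =>
    obtain ⟨u, z, hu, hk⟩ := ih (p ++ [a]) x (fun q b z hq => h q b z (by simp at hq ⊢; omega))
    refine ⟨a :: u, z, by simp [hu], ?_⟩
    rw [blockSum, blockSum_eq_zero_of_length E k p, zero_add, hE.map_one]
    · simpa using hk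
    · intro q b z hq
      exact h q b z (by simp; omega)

theorem blockSum_closeBlock_eq_full {E : M →ₗ[ℂ] B} (hE : IsCondExp B.val E) (κ : List M → B)
    (a : M) (l : List M) (h : ∀ q, q ≠ [] → q.length < l.length + 1 → κ q = 0) :
    blockSum E (closeBlock E κ) [] a 1 l = κ (a :: l) := by
  obtain ⟨u, z, hu, hk⟩ := blockSum_eq_full hE (closeBlock E κ) [] a l (fun q b z hq =>
    h _ (by simp) (by simp at hq ⊢; omega))
  rw [hk, hu, closeBlock, hE.map_one]
  simp

variable {E}

theorem IsAdditiveBracket.closeBlock {br : List M → B} (hbr : IsAdditiveBracket br) :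
    IsAdditiveKernel (closeBlock E br) where
  add_closed u x y v a h := by simp [_root_.closeBlock, hbr.add]
  add_last p x y h := by simp [_root_.closeBlock, hbr.add, add_mul]
  add_gap p a x y := by simp [_root_.closeBlock, hbr.add, mul_add]

/-- The three entries must be handled together: choosing a letter moves `a` and `E y` into the
closed list, so additivity in the last element or in the gap becomes additivity in a closed entry.
-/
theorem IsAdditiveKernel.blockSum {k : List M → M → M → B} (hk : IsAdditiveKernel k) (l : List M) :
    IsAdditiveKernel (fun p a y => blockSum E k p a y l) := by
  induction l with
  | nil => exact hk
  | cons x l ih =>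
    refine ⟨fun u z w v a h => ?_, fun p z w h => ?_, fun p a z w => ?_⟩
    · have h1 := ih.add_closed u z w v
      have h2 := ih.add_closed u z w (v ++ [a * (E h : M)]) x 1
      simp only [_root_.blockSum, h1, List.append_assoc, List.cons_append] at h2 ⊢
      rw [h2]; abel
    · have h1 := ih.add_closed p (z * (E h : M)) (w * (E h : M)) [] x 1
      simp only [_root_.blockSum, ih.add_last, add_mul, h1]; abel
    · have h1 := ih.add_closed p (a * (E z : M)) (a * (E w : M)) [] x 1
      simp only [_root_.blockSum, add_mul, ih.add_gap, map_add, Subalgebra.coe_add, mul_add, h1]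
      abel

theorem IsAdditiveKernel.blockSum_add_letter {k : List M → M → M → B} (hk : IsAdditiveKernel k)
    (p : List M) (a y : M) (u : List M) (x x' : M) (v : List M) :
    _root_.blockSum E k p a y (u ++ (x + x') :: v) =
      _root_.blockSum E k p a y (u ++ x :: v) + _root_.blockSum E k p a y (u ++ x' :: v) := by
  rw [blockSum_append, blockSum_append, blockSum_append, ← blockSum_add]
  congr 1
  funext p a y
  have h := hk.blockSum (E := E) v
  simp only [_root_.blockSum, mul_add, h.add_gap, h.add_last]
  abel

theorem blockSum_mul_right (hE : IsCondExp B.val E) {κ : List M → B} (hκ : IsAdditiveBracket κ)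
    (p : List M) (a y : M) (u : List M) (x : M) (b : B) :
    blockSum E (closeBlock E κ) p a y (u ++ [x * (b : M)]) =
      blockSum E (closeBlock E κ) p a y (u ++ [x]) * b := by
  rw [blockSum_append, blockSum_append, map_blockSum E _ (· * b) (fun x y => add_mul x y b)]
  congr 1
  funext p a y
  simp only [blockSum, closeBlock, add_mul, ← hκ.mul_right, ← mul_assoc, hE.map_mul_right,
    hE.map_one, Subalgebra.coe_mul, Subalgebra.coe_one, mul_one]

/-- The product of `m i`, `i ∈ s`, in increasing order. -/
def orderedProd (m : ℕ → M) (s : Finset ℕ) : M := ((s.sort (· ≤ ·)).map m).prod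

theorem sort_insert_max {s : Finset ℕ} {a : ℕ} (h : ∀ x ∈ s, x < a) :
    (insert a s).sort (· ≤ ·) = s.sort (· ≤ ·) ++ [a] := by
  refine List.SortedLT.eq_of_mem_iff (Finset.sortedLT_sort _) ?_ (by simp [or_comm])
  refine List.Pairwise.sortedLT ?_
  rw [List.pairwise_append]
  exact ⟨(Finset.sortedLT_sort s).pairwise, by simp, by simpa using h⟩

/-- The points of `r` are decided from the smallest upwards. `V₀` is the part of the block already
chosen, with largest element `a`. The smallest point of `r` either extends the gap behind `a` or
becomes the new last element, which closes that gap; these are the two summands in the recursion of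
`blockSum`. -/
theorem sum_powerset_eq_blockSum (κ : List M → B) (m : ℕ → M) (s r : Finset ℕ) :
    ∀ (V₀ : Finset ℕ) (a : ℕ), r ⊆ s → a ∈ V₀ → a ∈ s → a ∉ r → (∀ v ∈ V₀, v ≤ a) →
      (∀ x ∈ r, ∀ z ∈ s, z ∉ r → z < x) →
      ∑ V ∈ r.powerset, κ (((V₀ ∪ V).sort (· ≤ ·)).map fun w =>
          m w * (E (orderedProd m (gapAfter s (V₀ ∪ V) w)) : M)) =
        blockSum E (closeBlock E κ)
          (((V₀.erase a).sort (· ≤ ·)).map fun w => m w * (E (orderedProd m (gapAfter s V₀ w)) : M))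
          (m a) (orderedProd m ((s \ r).filter (a < ·))) ((r.sort (· ≤ ·)).map m) := by
  induction r using Finset.induction_on_min with
  | empty =>
    intro V₀ a _ ha has _ hmax _
    have hsort : V₀.sort (· ≤ ·) = (V₀.erase a).sort (· ≤ ·) ++ [a] := by
      rw [← sort_insert_max, Finset.insert_erase ha]
      intro x hx
      rw [Finset.mem_erase] at hx
      exact lt_of_le_of_ne (hmax x hx.2) hx.1
    have hgap : gapAfter s V₀ a = (s \ ∅).filter (a < ·) := by
      ext z
      simp only [mem_gapAfter, Finset.sdiff_empty, Finset.mem_filter]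
      refine and_congr_right fun _ => and_iff_left_of_imp fun _ u hu hau => ?_
      exact absurd hau (not_lt.2 (hmax u hu))
    simp [blockSum, closeBlock, hsort, hgap]
  | insert x r hxr ih =>
    intro V₀ a hrs ha has har hmax hlt
    have hxr' : x ∉ r := fun h => lt_irrefl _ (hxr x h)
    have hax : a < x := hlt x (by simp) a has har
    have hxs : x ∈ s := hrs (by simp)
    have hxV : x ∉ V₀ := fun h => by have := hmax x h; omega
    have hV₀ : ∀ v ∈ V₀.erase a, v < a := by
      intro v hv
      rw [Finset.mem_erase] at hv
      exact lt_of_le_of_ne (hmax v hv.2) hv.1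
    have hlt' : ∀ y ∈ r, ∀ z ∈ s, z ∉ r → z < y := by
      intro y hy z hz hzr
      by_cases hzx : z = x
      · exact hzx ▸ hxr y hy
      · exact hlt y (by simp [hy]) z hz (by simp [hzx, hzr])
    have hgapset : (s \ r).filter (a < ·) = insert x ((s \ insert x r).filter (a < ·)) := by
      ext z
      simp only [Finset.mem_filter, Finset.mem_sdiff, Finset.mem_insert]
      constructor
      · rintro ⟨⟨h1, h2⟩, h3⟩
        by_cases hzx : z = x
        · exact Or.inl hzx
        · exact Or.inr ⟨⟨h1, by tauto⟩, h3⟩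
      · rintro (rfl | ⟨⟨h1, h2⟩, h3⟩)
        · exact ⟨⟨hxs, hxr'⟩, hax⟩
        · exact ⟨⟨h1, by tauto⟩, h3⟩
    have hprod : orderedProd m ((s \ r).filter (a < ·)) =
        orderedProd m ((s \ insert x r).filter (a < ·)) * m x := by
      rw [hgapset, orderedProd, sort_insert_max]
      · simp [orderedProd]
      · intro z hz
        simp only [Finset.mem_filter, Finset.mem_sdiff] at hz
        exact hlt x (by simp) z hz.1.1 hz.1.2
    have hgap0 : (s \ r).filter (x < ·) = ∅ := by
      refine Finset.filter_eq_empty_iff.2 fun z hz hxz => ?_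
      rw [Finset.mem_sdiff] at hz
      have := hlt x (by simp) z hz.1 (by
        rw [Finset.mem_insert]; rintro (h | h)
        · omega
        · exact hz.2 h)
      omega
    have hgapold : ∀ w ∈ V₀.erase a, gapAfter s (insert x V₀) w = gapAfter s V₀ w := by
      intro w hw
      ext z
      simp only [mem_gapAfter, Finset.forall_mem_insert]
      refine and_congr_right fun _ => and_congr_right fun _ => and_iff_right_of_imp fun h _ => ?_
      exact (h a ha (hV₀ w hw)).trans hax
    have hgapa : gapAfter s (insert x V₀) a = (s \ insert x r).filter (a < ·) := by
      ext z
      simp only [mem_gapAfter, Finset.forall_mem_insert, Finset.mem_filter, Finset.mem_sdiff]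
      rw [Finset.mem_insert]
      constructor
      · rintro ⟨h1, h2, h3, -⟩
        refine ⟨⟨h1, ?_⟩, h2⟩
        rintro (rfl | hzr)
        · exact absurd (h3 hax) (lt_irrefl _)
        · exact absurd (h3 hax) (not_lt.2 (hxr z hzr).le)
      · rintro ⟨⟨h1, h2⟩, h3⟩
        refine ⟨h1, h3, fun _ => hlt x (by simp) z h1 (by simpa using h2), fun u hu hau => ?_⟩
        exact absurd hau (not_lt.2 (hmax u hu))
    have hclosed : (((insert x V₀).erase x).sort (· ≤ ·)).map (fun w =>
          m w * (E (orderedProd m (gapAfter s (insert x V₀) w)) : M)) =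
        ((V₀.erase a).sort (· ≤ ·)).map (fun w =>
          m w * (E (orderedProd m (gapAfter s V₀ w)) : M)) ++
          [m a * (E (orderedProd m ((s \ insert x r).filter (a < ·))) : M)] := by
      rw [Finset.erase_insert hxV]
      conv_lhs => rw [← Finset.insert_erase ha]
      rw [sort_insert_max hV₀, List.map_append, Finset.insert_erase ha, List.map_singleton, hgapa]
      congr 1
      refine List.map_congr_left fun w hw => ?_
      rw [hgapold w (by simpa using hw)]
    rw [Finset.sum_powerset_insert hxr',
      ih V₀ a (fun z hz => hrs (by simp [hz])) ha has (fun h => har (by simp [h])) hmax hlt',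
      Finset.sort_insert _ (fun b hb => (hxr b hb).le) hxr', List.map_cons, blockSum, hprod]
    congr 1
    have := ih (insert x V₀) x (fun z hz => hrs (by simp [hz])) (by simp) hxs hxr'
      (by
        intro v hv
        rcases Finset.mem_insert.1 hv with rfl | hv
        · exact le_rfl
        · exact ((hmax v hv).trans_lt hax).le) hlt'
    rw [hclosed, hgap0] at this
    simp only [Finset.insert_union, Finset.union_insert] at this ⊢
    rw [this]
    simp [orderedProd]

/-- Sums over non-crossing partitions as block sums, given the sums over the gaps. -/
theorem ncSum_eq_blockSum {br : List M → B} (hbr : IsAdditiveBracket br) (m : ℕ → M)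
    {s : Finset ℕ} (h : ∀ g : Finset ℕ, g.card < s.card → ncSum br m g = E (orderedProd m g))
    {a : M} {l : List M} (hl : (s.sort (· ≤ ·)).map m = a :: l) :
    ncSum br m s = blockSum E (closeBlock E br) [] a 1 l := by
  have hne : s.Nonempty := by
    rw [Finset.nonempty_iff_ne_empty]
    rintro rfl
    simp at hl
  obtain ⟨a₀, ha₀, hmin⟩ : ∃ a₀ ∈ s, ∀ x ∈ s, a₀ ≤ x := ⟨_, s.min'_mem hne, fun x hx => s.min'_le x hx⟩
  have hsort : s.sort (· ≤ ·) = a₀ :: (s.erase a₀).sort (· ≤ ·) := by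
    rw [← Finset.sort_insert _ _ (Finset.notMem_erase a₀ s), Finset.insert_erase ha₀]
    exact fun b hb => hmin b (Finset.mem_of_mem_erase hb)
  rw [hsort, List.map_cons, List.cons.injEq] at hl
  rw [ncSum_eq hbr m ha₀ hmin]
  have key := sum_powerset_eq_blockSum (E := E) br m s (s.erase a₀) {a₀} a₀ (s.erase_subset a₀)
    (by simp) ha₀ (by simp) (by simp) (by
      intro x hx z hz hzr
      rw [Finset.mem_erase] at hx hzr
      obtain rfl : z = a₀ := by tauto
      exact lt_of_le_of_ne (hmin x hx.2) hx.1.symm)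
  have hfilter : (s \ s.erase a₀).filter (a₀ < ·) = ∅ := by
    refine Finset.filter_eq_empty_iff.2 fun z hz => ?_
    simp only [Finset.mem_sdiff, Finset.mem_erase] at hz
    have : z = a₀ := by tauto
    omega
  rw [hfilter, hl.1, hl.2] at key
  simp only [Finset.erase_singleton, Finset.sort_empty, List.map_nil, orderedProd,
    List.prod_nil] at key
  rw [← key]
  refine Finset.sum_bij (fun V _ => V.erase a₀) ?_ ?_ ?_ ?_
  · intro V hV
    simp only [Finset.mem_filter, Finset.mem_powerset] at hV ⊢
    exact Finset.erase_subset_erase _ hV.1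
  · intro V hV V' hV' hVV'
    simp only [Finset.mem_filter] at hV hV'
    rw [← Finset.insert_erase hV.2, hVV', Finset.insert_erase hV'.2]
  · intro V hV
    rw [Finset.mem_powerset] at hV
    refine ⟨insert a₀ V, ?_, Finset.erase_insert (fun h => by simpa using hV h)⟩
    simp only [Finset.mem_filter, Finset.mem_powerset, Finset.mem_insert, true_or, and_true]
    exact Finset.insert_subset ha₀ (hV.trans (s.erase_subset a₀))
  · intro V hV
    simp only [Finset.mem_filter, Finset.mem_powerset] at hV
    rw [← Finset.insert_eq, Finset.insert_erase hV.2]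
    refine congrArg br (List.map_congr_left fun w hw => ?_)
    rw [h, orderedProd]
    refine Finset.card_lt_card ⟨gapAfter_subset w, fun hsub => ?_⟩
    exact notMem_of_mem_gapAfter (hsub ha₀) hV.2

/-! ### Additivity of cumulants and the moment-cumulant recursion -/

theorem orderedProd_range_getD {M : Type*} [Ring M] (l : List M) :
    ((Finset.range l.length).sort (· ≤ ·)).map (fun i => l.getD i 0) = l := by
  rw [Finset.sort_range]
  refine List.ext_getElem (by simp) fun i h1 h2 => ?_
  simp [h2]

/-- A bracket, cut off at length `n`. -/
def truncBracket (br : List M → B) (n : ℕ) (l : List M) : B := if l.length < n then br l else 0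

/-- The zero bracket is additive, so only lists below the cut-off matter. This lets the block
expansion be applied before additivity is known at all lengths. -/
theorem isAdditiveBracket_truncBracket {br : List M → B} {n : ℕ}
    (h1 : ∀ (u : List M) (x y : M) (v : List M), u.length + v.length + 1 < n →
      br (u ++ (x + y) :: v) = br (u ++ x :: v) + br (u ++ y :: v))
    (h2 : ∀ (u : List M) (x : M) (b : B), u.length + 1 < n →
      br (u ++ [x * (b : M)]) = br (u ++ [x]) * b) :
    IsAdditiveBracket (truncBracket br n) where
  add u x y v := by
    simp only [truncBracket, List.length_append, List.length_cons]
    split_ifs with h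
    · exact h1 u x y v (by omega)
    · simp
  mul_right u x b := by
    simp only [truncBracket, List.length_append, List.length_cons]
    split_ifs with h
    · exact h2 u x b (by simpa using h)
    · simp

theorem ncSum_truncBracket (br : List M → B) (m : ℕ → M) {n : ℕ} {s : Finset ℕ} (hs : s.card < n) :
    ncSum (truncBracket br n) m s = ncSum br m s := by
  refine Finset.sum_congr rfl fun π _ => bracketing_congr _ _ _ _ (fun l a hl => ?_) _
  rw [truncBracket, if_pos]
  rw [hl]
  exact (Finset.card_le_card (π.part_subset a)).trans_lt hs

/-- The one-block partition needs no exclusion from the sum: its bracket has full length and is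
removed by the cut-off. -/
theorem cumulantMap_eq_sub_ncSum (E : M →ₗ[ℂ] B) {l : List M} (hl : l ≠ []) :
    cumulantMap E l = E l.prod -
      ncSum (truncBracket (cumulantMap E) l.length) (fun i => l.getD i 0)
        (Finset.range l.length) := by
  classical
  have hne : (Finset.range l.length).Nonempty :=
    Finset.nonempty_range_iff.2 (List.length_pos_iff.2 hl).ne'
  rw [cumulantMap, momentMap]
  congr 1
  rw [ncSum]
  have htr : (fun l' : List M => if _h : l'.length < l.length then cumulantMap E l' else 0) =
      truncBracket (cumulantMap E) l.length := by
    funext l'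
    simp [truncBracket]
  rw [htr]
  refine Finset.sum_subset_zero_on_sdiff (Finset.filter_subset _ _) (fun π hπ => ?_)
    (fun _ _ => rfl)
  have hparts : π.parts = {Finset.range l.length} := by
    rw [Finset.mem_sdiff, Finset.mem_filter] at hπ
    by_contra h
    exact hπ.2 ⟨hπ.1, h⟩
  have hpart : π.part ((Finset.range l.length).min' hne) = Finset.range l.length := by
    have := π.part_mem.2 (Finset.min'_mem _ hne)
    rwa [hparts, Finset.mem_singleton] at this
  rw [bracketing, dif_pos hne, hpart, truncBracket, if_neg (by simp), zero_mul]

/-- The three claims need each other. The block expansion requires an additive bracket and moments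
on the gaps, both known at shorter lengths; it expresses a cumulant as a moment minus a block sum of
shorter cumulants. Both terms are additive and right `B`-linear, which extends these properties by
one length and gives the formula for the moments in turn. -/
theorem cumulantMap_induction (hE : IsCondExp B.val E) (n : ℕ) :
    (∀ (u : List M) (x y : M) (v : List M), u.length + v.length + 1 < n →
      cumulantMap E (u ++ (x + y) :: v) =
        cumulantMap E (u ++ x :: v) + cumulantMap E (u ++ y :: v)) ∧
    (∀ (u : List M) (x : M) (b : B), u.length + 1 < n →
      cumulantMap E (u ++ [x * (b : M)]) = cumulantMap E (u ++ [x]) * b) ∧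
    (∀ (m : ℕ → M) (s : Finset ℕ), s.card < n →
      ncSum (cumulantMap E) m s = E (orderedProd m s)) := by
  induction n with
  | zero => simp
  | succ n ih =>
    obtain ⟨h1, h2, h3⟩ := ih
    have hbr := isAdditiveBracket_truncBracket h1 h2
    have hk := hbr.closeBlock (E := E)
    have hc : ∀ (a : M) (l : List M), l.length + 1 = n → cumulantMap E (a :: l) =
        E (a * l.prod) - blockSum E (closeBlock E (truncBracket (cumulantMap E) n)) [] a 1 l := by
      intro a l hl
      rw [cumulantMap_eq_sub_ncSum E (by simp), List.prod_cons]
      congr 1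
      rw [List.length_cons, hl]
      refine ncSum_eq_blockSum hbr _ (fun g hg => ?_) ?_
      · rw [Finset.card_range] at hg
        rw [ncSum_truncBracket _ _ hg, h3 _ _ hg]
      · rw [← hl]
        exact orderedProd_range_getD (a :: l)
    have h1' : ∀ (u : List M) (x y : M) (v : List M), u.length + v.length + 1 < n + 1 →
        cumulantMap E (u ++ (x + y) :: v) =
          cumulantMap E (u ++ x :: v) + cumulantMap E (u ++ y :: v) := by
      intro u x y v hlen
      rcases Nat.lt_succ_iff_lt_or_eq.1 hlen with hlt | heq
      · exact h1 u x y v hlt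
      · rcases u with _ | ⟨a, u⟩
        · simp only [List.nil_append]
          rw [hc _ _ (by simpa using heq), hc _ _ (by simpa using heq), hc _ _ (by simpa using heq),
            (hk.blockSum v).add_last, add_mul, map_add]
          abel
        · simp only [List.cons_append]
          have hl : ∀ z : M, (u ++ z :: v).length + 1 = n := by
            intro z; simp at heq ⊢; omega
          rw [hc _ _ (hl _), hc _ _ (hl _), hc _ _ (hl _), hk.blockSum_add_letter]
          simp only [List.prod_append, List.prod_cons, mul_add, add_mul, map_add]
          abel
    have h2' : ∀ (u : List M) (x : M) (b : B), u.length + 1 < n + 1 →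
        cumulantMap E (u ++ [x * (b : M)]) = cumulantMap E (u ++ [x]) * b := by
      intro u x b hlen
      rcases Nat.lt_succ_iff_lt_or_eq.1 hlen with hlt | heq
      · exact h2 u x b hlt
      · rcases u with _ | ⟨a, u⟩
        · have hn : n = 1 := by simpa using heq.symm
          simp only [List.nil_append]
          rw [hc _ _ (by simp [hn]), hc _ _ (by simp [hn])]
          simp [blockSum, closeBlock, truncBracket, hn, hE.map_mul_right]
        · simp only [List.cons_append]
          have hl : ∀ z : M, (u ++ [z]).length + 1 = n := by
            intro z; simp at heq ⊢; omega
          rw [hc _ _ (hl _), hc _ _ (hl _), blockSum_mul_right hE hbr, sub_mul,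
            ← hE.map_mul_right]
          simp [mul_assoc]
    refine ⟨h1', h2', fun m s hs => ?_⟩
    rcases Nat.lt_succ_iff_lt_or_eq.1 hs with hlt | heq
    · exact h3 m s hlt
    · rw [← ncSum_truncBracket _ _ hs]
      have hbr' := isAdditiveBracket_truncBracket h1' h2'
      rcases hl : (s.sort (· ≤ ·)).map m with _ | ⟨a, l⟩
      · rw [List.map_eq_nil_iff] at hl
        have hs0 : s = ∅ := by
          rw [← Finset.sort_toFinset s (· ≤ ·), hl]; rfl
        subst hs0
        simp [ncSum, bracketing_empty, orderedProd, hE.map_one]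
        have : ncPartitions ∅ = {(Finpartition.empty (Finset ℕ))} := by
          refine Finset.eq_singleton_iff_unique_mem.2 ⟨mem_ncPartitions.2 ?_, fun π _ => ?_⟩
          · intro U hU
            simp [Finpartition.empty] at hU
          · exact Subsingleton.elim (α := Finpartition (⊥ : Finset ℕ)) _ _
        rw [this]; simp
      · have hlen : l.length + 1 = n := by
          have := congrArg List.length hl
          simp at this; omega
        rw [ncSum_eq_blockSum (E := E) hbr' m (fun g hg => ?_) hl, orderedProd, hl, List.prod_cons,
          eq_add_of_sub_eq' (hc a l hlen).symm]
        swap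
        · rw [ncSum_truncBracket _ _ (by omega), h3 _ _ (by omega)]
        -- The cut-offs at `n + 1` and at `n` differ only on lists of length `n`. The difference
        -- therefore contributes just the block of all letters, that is, the cumulant missing from
        -- the recursion.
        have hsplit : closeBlock E (truncBracket (cumulantMap E) (n + 1)) =
            fun p a y => closeBlock E (truncBracket (cumulantMap E) n) p a y +
              closeBlock E (fun q => truncBracket (cumulantMap E) (n + 1) q -
                truncBracket (cumulantMap E) n q) p a y := by
          funext p a y
          simp [closeBlock]
        rw [hsplit, blockSum_add, blockSum_closeBlock_eq_full hE (fun q =>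
          truncBracket (cumulantMap E) (n + 1) q - truncBracket (cumulantMap E) n q)]
        · simp [truncBracket, hlen]
        · intro q _ hq
          simp only [truncBracket]
          rw [if_pos (by omega), if_pos (by omega), sub_self]

theorem isAdditiveBracket_cumulantMap (hE : IsCondExp B.val E) :
    IsAdditiveBracket (cumulantMap E) where
  add u x y v := (cumulantMap_induction hE (u.length + v.length + 2)).1 u x y v (by omega)
  mul_right u x b := (cumulantMap_induction hE (u.length + 2)).2.1 u x b (by omega)

/-- The moment-cumulant formula, organised by the block of the first letter. -/
theorem moment_eq_blockSum (hE : IsCondExp B.val E) (a : M) (l : List M) :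
    E (a * l.prod) = blockSum E (closeBlock E (cumulantMap E)) [] a 1 l := by
  have h := fun m s => (cumulantMap_induction hE (s.card + 1)).2.2 m s (Nat.lt_succ_self _)
  have hl := orderedProd_range_getD (a :: l)
  rw [← ncSum_eq_blockSum (isAdditiveBracket_cumulantMap hE) _ (fun g _ => h _ g) hl, h,
    orderedProd, hl, List.prod_cons]

end BlockSum

/-! ### Cumulants with a product as an entry -/

section Products

variable {M : Type*} [Ring M] [Algebra ℂ M] {B : Subalgebra ℂ M}

/-- The sum of `f g h` over the ways to write a list as `g ++ h` with `h ≠ []`. -/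
def splitSum (f : List M → List M → B) : List M → B
  | [] => 0
  | z :: l => f [] (z :: l) + splitSum (fun g h => f (z :: g) h) l

theorem splitSum_concat (f : List M → List M → B) (l : List M) (z : M) :
    splitSum f (l ++ [z]) = splitSum (fun g h => f g (h ++ [z])) l + f l [z] := by
  induction l generalizing f with
  | nil => simp [splitSum]
  | cons a l ih => simp [splitSum, ih, add_assoc]

theorem splitSum_add (f f' : List M → List M → B) (l : List M) :
    splitSum (fun g h => f g h + f' g h) l = splitSum f l + splitSum f' l := by
  induction l generalizing f f' with
  | nil => simp [splitSum]
  | cons a l ih => simp only [splitSum, ih]; abel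

theorem map_splitSum (φ : B → B) (hφ : ∀ x y, φ (x + y) = φ x + φ y)
    (f : List M → List M → B) (l : List M) :
    φ (splitSum f l) = splitSum (fun g h => φ (f g h)) l := by
  induction l generalizing f with
  | nil => simpa [splitSum] using hφ 0 0
  | cons a l ih => simp only [splitSum, hφ, ih]

/-- The sum of `{U, x {r, Y₁}, Y₂}` over the ways to write `Y = Y₁ ++ Y₂` with `Y₁ ≠ []`. -/
noncomputable def nestRight (E : M →ₗ[ℂ] B) (x : M) (U : List M) : List M → List M → B
  | _, [] => 0
  | r, z :: Y => cumulantMap E (U ++ [x * (cumulantMap E (r ++ [z]) : M)] ++ Y) +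
      nestRight E x U (r ++ [z]) Y

/-- The sum of `κ (p, U₁ {U₂, x})` over the ways to write `U = U₁ ++ U₂` with `U₁ ≠ []`, where the
inner cumulant is multiplied to the last element of `U₁`. -/
noncomputable def nestLeft (E : M →ₗ[ℂ] B) (κ : List M → B) (x : M) : List M → List M → B
  | _, [] => 0
  | p, z :: r => κ (p ++ [z * (cumulantMap E (r ++ [x]) : M)]) + nestLeft E κ x (p ++ [z]) r

/-- The sum over all blocks that contain the last letter `x` and, if `l ≠ []`, the first letter
of `l`. -/
noncomputable def lastBlockSum (E : M →ₗ[ℂ] B) (x : M) : List M → B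
  | [] => cumulantMap E [x]
  | m :: l => blockSum E (closeBlock E fun q => cumulantMap E (q ++ [x])) [] m 1 l

variable {E : M →ₗ[ℂ] B}

theorem blockSum_closeBlock_prefix (κ : List M → B) (p : List M) (a y : M) (l : List M) :
    blockSum E (closeBlock E κ) p a y l =
      blockSum E (closeBlock E fun q => κ (p ++ q)) [] a y l := by
  have := blockSum_prefix E (closeBlock E κ) p [] a y l
  rw [List.append_nil] at this
  rw [this]
  congr 1
  funext q b h
  simp [closeBlock]

theorem cumulantMap_singleton (hE : IsCondExp B.val E) (x : M) : cumulantMap E [x] = E x := by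
  have := moment_eq_blockSum hE x []
  simpa [blockSum, closeBlock, hE.map_one] using this.symm

theorem blockSum_nestLeft_cons {κ : List M → B}
    (hκ : ∀ (u : List M) (x y : M), κ (u ++ [x + y]) = κ (u ++ [x]) + κ (u ++ [y]))
    (x : M) (p : List M) (a y m : M) (l : List M) :
    blockSum E (closeBlock E (nestLeft E κ x p)) [] a y (m :: l) =
      blockSum E (closeBlock E (nestLeft E κ x p)) [] a (y * m) l +
        (κ (p ++ [a * (E y : M) * (lastBlockSum E x (m :: l) : M)]) +
        blockSum E (closeBlock E (nestLeft E κ x (p ++ [a * (E y : M)]))) [] m 1 l) := by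
  rw [blockSum, List.nil_append, blockSum_closeBlock_prefix _ [a * (E y : M)], lastBlockSum,
    map_blockSum E _ (fun β : B => κ (p ++ [a * (E y : M) * (β : M)]))
      (fun β β' => by simp only [Subalgebra.coe_add, mul_add, hκ]), ← blockSum_add]
  rfl

/-- On the left `x` lies behind the last element of the outer block, and `E (h * x)` is expanded by
the block of `x`. Choosing both blocks is the same as choosing their union and cutting it into an
outer and an inner part, which is `nestLeft`. The letters `g` are already outside the outer block;
the second sum collects the terms in which the block of `x` starts in `g`. -/
theorem blockSum_nestLeft_of_lastBlock {κ : List M → B}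
    (hκ : ∀ (u : List M) (x y : M), κ (u ++ [x + y]) = κ (u ++ [x]) + κ (u ++ [y]))
    (x : M) (n : ℕ)
    (hlast : ∀ g : List M, g.length ≤ n → E (g.prod * x) =
      splitSum (fun g₀ g₁ => E g₀.prod * lastBlockSum E x g₁) g + E g.prod * cumulantMap E [x])
    (p : List M) (a : M) (g l : List M) (hn : g.length + l.length ≤ n) :
    blockSum E (fun p a h => κ (p ++ [a * (E (h * x) : M)])) p a g.prod l =
      blockSum E (closeBlock E (nestLeft E κ x p)) [] a g.prod l +
        splitSum (fun g₀ g₁ =>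
          κ (p ++ [a * ((E g₀.prod * lastBlockSum E x (g₁ ++ l) : B) : M)])) g := by
  have hadd : ∀ (p : List M) (a : M) (β β' : B), κ (p ++ [a * ((β + β' : B) : M)]) =
      κ (p ++ [a * (β : M)]) + κ (p ++ [a * (β' : M)]) := fun p a β β' => by
    simp only [Subalgebra.coe_add, mul_add, hκ]
  induction l generalizing p a g with
  | nil =>
    simp only [blockSum, closeBlock, List.nil_append, List.append_nil, nestLeft]
    rw [hlast g (by simpa using hn), hadd,
      map_splitSum (fun β : B => κ (p ++ [a * (β : M)])) (hadd p a)]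
    simp [mul_assoc, add_comm]
  | cons m l ih =>
    have h1 := ih p a (g ++ [m]) (by simp at hn ⊢; omega)
    have h2 := ih (p ++ [a * (E g.prod : M)]) m [] (by simp at hn ⊢; omega)
    rw [splitSum_concat] at h1
    simp only [List.prod_append, List.prod_singleton, List.prod_nil, splitSum, add_zero,
      List.append_assoc, List.singleton_append] at h1 h2
    rw [blockSum, h1, h2, blockSum_nestLeft_cons hκ]
    simp only [Subalgebra.coe_mul, mul_assoc]
    abel

/-- Here the inner cumulant stands behind the last entry of the outer one, so right `B`-linearity
turns it into a factor on the right. The outer blocks can then be summed up to a moment. -/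
theorem blockSum_nestLeft_cumulantMap (hE : IsCondExp B.val E) (x : M) (p : List M) (a y : M)
    (l : List M) :
    blockSum E (closeBlock E (nestLeft E (cumulantMap E) x p)) [] a y l =
      splitSum (fun l₀ l₁ =>
        blockSum E (closeBlock E (cumulantMap E)) p a y l₀ * lastBlockSum E x l₁) l +
      blockSum E (closeBlock E (cumulantMap E)) p a y l * cumulantMap E [x] := by
  have hc := isAdditiveBracket_cumulantMap hE
  induction l generalizing p a y with
  | nil => simp [blockSum, closeBlock, nestLeft, splitSum, hc.mul_right]
  | cons m l ih =>
    rw [blockSum_nestLeft_cons (fun u x y => hc.add u x y []), ih, ih, splitSum, hc.mul_right]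
    simp only [blockSum, add_mul, splitSum_add, closeBlock]
    abel

/-- The moment-cumulant formula, organised by the block of the last letter. -/
theorem moment_eq_lastBlockSum (hE : IsCondExp B.val E) (x : M) (l : List M) :
    E (l.prod * x) = splitSum (fun l₀ l₁ => E l₀.prod * lastBlockSum E x l₁) l +
      E l.prod * cumulantMap E [x] := by
  have hc := isAdditiveBracket_cumulantMap hE
  induction hn : l.length using Nat.strong_induction_on generalizing l with
  | _ n ih =>
    rcases l with _ | ⟨m, l⟩
    · simp [splitSum, hE.map_one, cumulantMap_singleton hE]
    · have h1 := moment_eq_blockSum hE m (l ++ [x])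
      -- The induction hypothesis applies to every gap behind the block of the first letter `m`,
      -- because a gap omits `m`.
      have h2 := blockSum_nestLeft_of_lastBlock (E := E) (κ := cumulantMap E)
        (fun u x y => hc.add u x y []) x l.length
        (fun g hg => ih g.length (by simp at hn; omega) g rfl) [] m [] l (by simp)
      simp only [List.prod_nil, splitSum, add_zero] at h2
      rw [blockSum_nestLeft_cumulantMap hE] at h2
      have h3 : (fun l₀ : List M => blockSum E (closeBlock E (cumulantMap E)) [] m 1 l₀) =
          fun l₀ => E (m * l₀.prod) := funext fun l₀ => (moment_eq_blockSum hE m l₀).symm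
      simp only [← moment_eq_blockSum hE] at h2
      rw [blockSum_append] at h1
      simp only [blockSum, closeBlock] at h1
      rw [blockSum_add, h2] at h1
      simp only [List.prod_append, List.prod_singleton] at h1
      rw [List.prod_cons, mul_assoc, h1, splitSum, List.prod_nil, hE.map_one, one_mul,
        lastBlockSum]
      simp only [List.prod_cons, Subalgebra.coe_one, mul_one]
      abel

theorem blockSum_nestRight_cons (x : M) (U q : List M) (z h m : M) (v : List M) :
    blockSum E (closeBlock E (nestRight E x U q)) [] z h (m :: v) =
      blockSum E (closeBlock E (nestRight E x U q)) [] z (h * m) v +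
      (blockSum E (closeBlock E (cumulantMap E))
        (U ++ [x * (cumulantMap E (q ++ [z * (E h : M)]) : M)]) m 1 v +
      blockSum E (closeBlock E (nestRight E x U (q ++ [z * (E h : M)]))) [] m 1 v) := by
  rw [blockSum, List.nil_append, blockSum_closeBlock_prefix _ [z * (E h : M)],
    blockSum_closeBlock_prefix _ (U ++ _), ← blockSum_add]
  rfl

/-- The gap behind `x` begins with `y` and is expanded by the block of `y`. The list `s` holds the
letters already put into that gap; each letter of `v` joins the gap or the outer block. The chosen
letters thus form an initial run in the block of `y` followed by a run in the outer block, as in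
`nestRight`. -/
theorem blockSum_eq_nestRight (hE : IsCondExp B.val E) (x y : M) (U v s : List M) :
    blockSum E (closeBlock E (cumulantMap E)) U x (y * s.prod) v =
      blockSum E (fun q z h => blockSum E (closeBlock E (nestRight E x U q)) [] z h v)
        [] y 1 s := by
  have hc := isAdditiveBracket_cumulantMap hE
  induction v generalizing s with
  | nil =>
    simp only [blockSum, closeBlock, List.nil_append, nestRight, List.append_nil, add_zero]
    rw [moment_eq_blockSum hE, map_blockSum E _
      (fun β : B => cumulantMap E (U ++ [x * (β : M)]))
      (fun β β' => by simp only [Subalgebra.coe_add, mul_add, hc.add U _ _ []])]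
    rfl
  | cons m v ih =>
    have hk := (hc.closeBlock (E := E)).blockSum (E := E) v
    have h1 := ih (s ++ [m])
    rw [blockSum_append] at h1
    simp only [List.prod_append, List.prod_singleton, ← mul_assoc] at h1
    rw [blockSum, h1, moment_eq_blockSum hE, map_blockSum E _
      (fun β : B => blockSum E (closeBlock E (cumulantMap E)) (U ++ [x * (β : M)]) m 1 v)
      (fun β β' => by simp only [Subalgebra.coe_add, mul_add, hk.add_closed U _ _ []]),
      ← blockSum_add]
    congr 1
    funext q z h
    rw [blockSum_nestRight_cons]
    simp only [blockSum, closeBlock]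
    abel

/-- Multiplying the first element of a list from the left. -/
def mulHead (x : M) : List M → List M
  | [] => []
  | y :: v => (x * y) :: v

theorem blockSum_mulHead_cons (κ : List M → B) (x : M) (p r : List M) (z a y : M) (l : List M) :
    blockSum E (closeBlock E κ) (p ++ (x * z) :: r) a y l =
      blockSum E (closeBlock E fun Y => κ (p ++ mulHead x Y)) (z :: r) a y l := by
  induction l generalizing r a y with
  | nil => simp [blockSum, closeBlock, mulHead]
  | cons m l ih =>
    simp only [blockSum, ih]
    rw [List.append_assoc, List.cons_append, ih]
    rfl

theorem blockSum_mulHead (κ : List M → B) (x : M) (p : List M) (a y : M) (l : List M) :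
    blockSum E (closeBlock E κ) p (x * a) y l =
      blockSum E (closeBlock E fun Y => κ (p ++ mulHead x Y)) [] a y l := by
  induction l generalizing y with
  | nil => simp [blockSum, closeBlock, mulHead, mul_assoc]
  | cons m l ih =>
    simp only [blockSum, ih, List.nil_append, mul_assoc]
    rw [blockSum_mulHead_cons]

theorem nestLeft_blockSum (f : List M → List M → B) (x : M) (p r : List M) (y : M) (v : List M) :
    nestLeft E (fun U => blockSum E (closeBlock E (f U)) [] y 1 v) x p r =
      blockSum E (closeBlock E fun Y => nestLeft E (fun U => f U Y) x p r) [] y 1 v := by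
  induction r generalizing p with
  | nil =>
    simp only [nestLeft]
    rw [blockSum_eq_zero_of_length]
    intros; rfl
  | cons z r ih =>
    simp only [nestLeft, ih]
    rw [← blockSum_add]
    rfl

/-- The moments of `u, xy, v` and of `u, x, y, v` coincide. Expanding both by the first block shows
that the defects of the claimed identity, summed over all blocks, add up to zero. By induction the
defects of shorter lists vanish, and what remains is the defect of the full list. -/
theorem cumulantMap_mulHead (hE : IsCondExp B.val E) (x : M) (U Y : List M) (hY : Y ≠ []) :
    cumulantMap E (U ++ mulHead x Y) - (cumulantMap E (U ++ x :: Y) + nestRight E x U [] Y +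
      nestLeft E (fun U => cumulantMap E (U ++ Y)) x [] U) = 0 := by
  have hc := isAdditiveBracket_cumulantMap hE
  induction hn : U.length + Y.length using Nat.strong_induction_on generalizing U Y with
  | _ n ih =>
    obtain ⟨y, v, rfl⟩ := List.exists_cons_of_ne_nil hY
    set δ : List M → List M → B := fun U Y =>
      cumulantMap E (U ++ mulHead x Y) - (cumulantMap E (U ++ x :: Y) + nestRight E x U [] Y +
        nestLeft E (fun U => cumulantMap E (U ++ Y)) x [] U) with hδ
    -- The terms subtracted correspond to the positions of `x` and `y` relative to the outer block:
    -- both in it, only `x` in it, and only `y` in it with the block of `x` nested to the left.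
    have hδsum : ∀ U, blockSum E (closeBlock E (δ U)) [] y 1 v =
        blockSum E (closeBlock E (cumulantMap E)) U (x * y) 1 v -
        (blockSum E (closeBlock E (cumulantMap E)) (U ++ [x]) y 1 v +
          blockSum E (closeBlock E (cumulantMap E)) U x y v +
          nestLeft E (fun U => blockSum E (closeBlock E (cumulantMap E)) U y 1 v) x [] U) := by
      intro U
      have hQ := blockSum_eq_nestRight hE x y U v []
      simp only [List.prod_nil, mul_one, blockSum] at hQ
      have hP : (fun U => blockSum E (closeBlock E (cumulantMap E)) U y 1 v) =
          fun U => blockSum E (closeBlock E fun Y => cumulantMap E (U ++ Y)) [] y 1 v :=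
        funext fun U => blockSum_closeBlock_prefix _ U _ _ _
      rw [blockSum_mulHead, hQ, hP, nestLeft_blockSum, blockSum_closeBlock_prefix _ (U ++ [x]),
        ← blockSum_add, ← blockSum_add, ← blockSum_sub]
      simp [hδ, closeBlock]
      rfl
    have hfull : ∀ U, U.length + (v.length + 1) = n →
        blockSum E (closeBlock E (δ U)) [] y 1 v = δ U (y :: v) := by
      intro U hU
      refine blockSum_closeBlock_eq_full hE _ _ _ fun q hq hlen => ?_
      exact ih _ (by omega) U q hq rfl
    change δ U (y :: v) = 0
    rw [← hfull U (by simpa using hn)]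
    rcases U with _ | ⟨a, u⟩
    · have h1 := moment_eq_blockSum hE (x * y) v
      have h2 := moment_eq_blockSum hE x (y :: v)
      rw [List.prod_cons, ← mul_assoc, h1] at h2
      rw [hδsum, h2]
      simp [blockSum, nestLeft, hE.map_one]
      abel
    · have h1 := moment_eq_blockSum hE a (u ++ (x * y) :: v)
      have h2 := moment_eq_blockSum hE a (u ++ x :: y :: v)
      have hprod : (u ++ (x * y) :: v).prod = (u ++ x :: y :: v).prod := by simp [mul_assoc]
      rw [hprod, h2, blockSum_append, blockSum_append] at h1
      have hk := (hc.closeBlock (E := E)).blockSum (E := E) v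
      have hP := blockSum_nestLeft_of_lastBlock (E := E)
        (κ := fun U => blockSum E (closeBlock E (cumulantMap E)) U y 1 v)
        (fun u x y => hk.add_closed u x y [] _ _) x u.length
        (fun g _ => moment_eq_lastBlockSum hE x g) [] a [] u (by simp)
      simp only [List.prod_nil, splitSum, add_zero] at hP
      have hzero : blockSum E
          (closeBlock E fun U => blockSum E (closeBlock E (δ U)) [] y 1 v) [] a 1 u = 0 := by
        -- Splitting on `x` and `y`, the terms with neither in the block cancel between the two
        -- expansions. Those with `y` but not `x` are removed and replaced by their `nestLeft` form,
        -- which has the same sum by `hP`.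
        have hker : (closeBlock E fun U => blockSum E (closeBlock E (δ U)) [] y 1 v) =
            fun p b g => blockSum E (closeBlock E (cumulantMap E)) p b g ((x * y) :: v) -
              (blockSum E (closeBlock E (cumulantMap E)) p b g (x :: y :: v) -
              blockSum E (closeBlock E (cumulantMap E)) (p ++ [b * (E (g * x) : M)]) y 1 v +
              closeBlock E (nestLeft E
                (fun U => blockSum E (closeBlock E (cumulantMap E)) U y 1 v) x []) p b g) := by
          funext p b g
          simp only [closeBlock, hδsum]
          simp only [blockSum, hE.map_one, Subalgebra.coe_one, mul_one, one_mul, mul_assoc]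
          abel
        rw [hker, blockSum_sub, blockSum_add, blockSum_sub, ← h1, hP]
        abel
      rw [← hzero, eq_comm]
      refine blockSum_closeBlock_eq_full hE
        (fun U => blockSum E (closeBlock E (δ U)) [] y 1 v) a u fun q hq hlen => ?_
      refine blockSum_eq_zero_of_length E _ _ _ _ _ fun r b z hr => ?_
      refine ih _ ?_ q (r ++ [b * (E z : M)]) (by simp) rfl
      simp at hr hn ⊢
      omega

/-- Cumulants with a product as an entry. -/
theorem cumulantMap_product (hE : IsCondExp B.val E) (u v : List M) (x y : M) :
    cumulantMap E (u ++ (x * y) :: v) = cumulantMap E (u ++ x :: y :: v) +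
      nestRight E x u [] (y :: v) + nestLeft E (fun U => cumulantMap E (U ++ y :: v)) x [] u :=
  sub_eq_zero.1 (cumulantMap_mulHead hE x u (y :: v) (by simp))

end Products

/-! ### Cumulants with entries from `B`, and scalar cumulants -/

section ScalarCumulants

variable {M : Type*} [Ring M] [Algebra ℂ M] {B D : Subalgebra ℂ M}

theorem cumulantMap_zero_entry {E : M →ₗ[ℂ] B} (hE : IsCondExp B.val E) (u v : List M) :
    cumulantMap E (u ++ 0 :: v) = 0 := by
  simpa using (isAdditiveBracket_cumulantMap hE).add u 0 0 v

theorem cumulantMap_eq_zero_of_mem {E : M →ₗ[ℂ] B} (hE : IsCondExp B.val E) {l : List M}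
    (h : (0 : M) ∈ l) : cumulantMap E l = 0 := by
  obtain ⟨u, v, rfl⟩ := List.append_of_mem h
  exact cumulantMap_zero_entry hE u v

/-- In the expansion of `E (b * m * ⋯)` the block `{b}` alone already gives `b * E (m * ⋯)`, which
is the whole moment. Longer blocks below full length vanish by induction, so the full one must
vanish too. -/
theorem cumulantMap_coe_cons {E : M →ₗ[ℂ] B} (hE : IsCondExp B.val E) (b : B) (v : List M)
    (hv : v ≠ []) : cumulantMap E ((b : M) :: v) = 0 := by
  induction hn : v.length using Nat.strong_induction_on generalizing b v with
  | _ n ih =>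
    obtain ⟨m, v, rfl⟩ := List.exists_cons_of_ne_nil hv
    have hrec : ∀ (l : List M) (y : M), l.length < n →
        blockSum E (closeBlock E (cumulantMap E)) [] (b : M) y l = b * E (y * l.prod) := by
      intro l
      induction l with
      | nil =>
        intro y _
        simp [blockSum, closeBlock, cumulantMap_singleton hE, hE.map_mul_left, hE.map_coe]
      | cons m' l ihl =>
        intro y hl
        have h0 : blockSum E (closeBlock E (cumulantMap E)) ([] ++ [(b : M) * (E y : M)]) m' 1 l
            = 0 := by
          rw [blockSum_closeBlock_prefix]
          refine blockSum_eq_zero_of_length E _ _ _ _ _ fun q c z hq => ?_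
          have := ih (q.length + 1) (by simp at hq hl; omega) (b * E y) (q ++ [c * (E z : M)])
            (by simp) (by simp)
          simpa [closeBlock] using this
        rw [blockSum, h0, add_zero, ihl _ (by simp at hl; omega), List.prod_cons, mul_assoc]
    have hfull : blockSum E (closeBlock E (cumulantMap E)) ([] ++ [(b : M)]) m 1 v =
        cumulantMap E ((b : M) :: m :: v) := by
      rw [blockSum_closeBlock_prefix, blockSum_closeBlock_eq_full hE]
      · rfl
      · intro q hq hlen
        exact ih q.length (by simp at hn; omega) b q hq rfl
    have h := moment_eq_blockSum hE (b : M) (m :: v)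
    rw [blockSum, hE.map_one, Subalgebra.coe_one, mul_one, hfull, one_mul,
      hrec v m (by simp at hn; omega), hE.map_mul_left, List.prod_cons] at h
    simpa using h

theorem nestRight_coe {E : M →ₗ[ℂ] B} (hE : IsCondExp B.val E) (w : M) (U : List M) (b : B)
    (r Y : List M) : nestRight E w U ((b : M) :: r) Y = 0 := by
  induction Y generalizing r with
  | nil => rfl
  | cons z Y ih =>
    rw [nestRight, List.cons_append, ih, cumulantMap_coe_cons hE b _ (by simp)]
    simp [cumulantMap_zero_entry hE]

theorem nestLeft_eq_zero {E : M →ₗ[ℂ] B} {κ : List M → B} (x : M) (p r : List M)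
    (h : ∀ q, q ≠ [] → q.length ≤ p.length + r.length → κ q = 0) : nestLeft E κ x p r = 0 := by
  induction r generalizing p with
  | nil => rfl
  | cons z r ih =>
    rw [nestLeft, ih _ (fun q hq hlen => h q hq (by simp at hlen ⊢; omega)),
      h _ (by simp) (by simp), add_zero]

/-- Cumulants of order at least two with an entry from `B` vanish. -/
theorem cumulantMap_coe_entry {E : M →ₗ[ℂ] B} (hE : IsCondExp B.val E) (u : List M) (b : B)
    (v : List M) (huv : u ++ v ≠ []) : cumulantMap E (u ++ (b : M) :: v) = 0 := by
  induction hn : u.length using Nat.strong_induction_on generalizing u with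
  | _ n ih =>
    rcases List.eq_nil_or_concat u with rfl | ⟨u, w, rfl⟩
    · exact cumulantMap_coe_cons hE b v (by simpa using huv)
    · rw [List.concat_eq_append] at hn ⊢
      -- Apply the product formula to the entry `w * b`. The nested term `{u, w {b}, v}` equals the
      -- left side. The other nested terms contain a shorter cumulant with the entry `b` and vanish,
      -- so `{u, w, b, v}` is zero.
      have h := cumulantMap_product hE u v w (b : M)
      rw [nestLeft_eq_zero, nestRight, List.nil_append, nestRight_coe hE] at h
      · simp only [cumulantMap_singleton hE, hE.map_coe, add_zero,
          List.append_assoc, List.singleton_append] at h ⊢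
        simpa using h
      · intro q hq hlen
        exact ih q.length (by simp at hn hlen; omega) q (by simp [hq]) rfl

theorem cumulantMap_eq_zero_of_coe_mem {E : M →ₗ[ℂ] B} (hE : IsCondExp B.val E) {l : List M}
    (hl : 2 ≤ l.length) {b : B} (h : (b : M) ∈ l) : cumulantMap E l = 0 := by
  obtain ⟨u, v, rfl⟩ := List.append_of_mem h
  refine cumulantMap_coe_entry hE u b v ?_
  rintro h0
  rw [List.append_eq_nil_iff] at h0
  simp [h0] at hl

/-- If the moments of all non-empty runs of consecutive letters of `l` vanish, then the moment of
`a :: l` is its cumulant. -/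
theorem moment_eq_cumulantMap_of_infix {E : M →ₗ[ℂ] B} (hE : IsCondExp B.val E) (a : M) (l : List M)
    (h : ∀ g, g ≠ [] → g <:+: l → E g.prod = 0) : E (a * l.prod) = cumulantMap E (a :: l) := by
  have hk := (isAdditiveBracket_cumulantMap hE).closeBlock (E := E)
  have h0 : ∀ (l g p : List M) (a : M), g ≠ [] →
      (∀ g', g' ≠ [] → g' <:+: g ++ l → E g'.prod = 0) →
      blockSum E (closeBlock E (cumulantMap E)) p a g.prod l = 0 := by
    intro l
    induction l with
    | nil =>
      intro g p a hg hE0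
      simp [blockSum, closeBlock, hE0 g hg (by simp), cumulantMap_zero_entry hE]
    | cons m l ih =>
      intro g p a hg hE0
      have h1 := ih (g ++ [m]) p a (by simp) (by simpa using hE0)
      have h2 := (hk.blockSum (E := E) l).add_closed p 0 0 [] m 1
      rw [List.prod_append, List.prod_singleton] at h1
      rw [blockSum, h1, hE0 g hg (List.prefix_append g _).isInfix]
      simpa using h2
  have h1 : ∀ (l p : List M) (a : M), (∀ g, g ≠ [] → g <:+: l → E g.prod = 0) →
      blockSum E (closeBlock E (cumulantMap E)) p a 1 l = cumulantMap E (p ++ a :: l) := by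
    intro l
    induction l with
    | nil => intro p a _; simp [blockSum, closeBlock, hE.map_one]
    | cons m l ih =>
      intro p a hE0
      have h2 := h0 l [m] p a (by simp) hE0
      rw [List.prod_singleton] at h2
      rw [blockSum, one_mul, h2, zero_add,
        ih _ _ (fun g hg hgl => hE0 g hg (hgl.trans (List.suffix_cons m l).isInfix)), hE.map_one]
      simp
  rw [moment_eq_blockSum hE, h1 l [] a h, List.nil_append]

/-- The letters `n bᵢ` of a list of elements `n` with coefficients `(bᵢ)`. -/
def letters (i : Bool) (L : List (M × (Bool → B))) : List M := L.map fun p => p.1 * (p.2 i : M)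

/-- The coefficient of the last letter. -/
def lastCoeff (i : Bool) (L : List (M × (Bool → B))) : B := (L.getLast?.map fun p => p.2 i).getD 1

theorem letters_append (i : Bool) (L L' : List (M × (Bool → B))) :
    letters i (L ++ L') = letters i L ++ letters i L' := List.map_append

theorem letters_cons (i : Bool) (p : M × (Bool → B)) (L : List (M × (Bool → B))) :
    letters i (p :: L) = p.1 * (p.2 i : M) :: letters i L := rfl

theorem lastCoeff_concat (i : Bool) (L : List (M × (Bool → B))) (p : M × (Bool → B)) :
    lastCoeff i (L ++ [p]) = p.2 i := by
  simp [lastCoeff]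

theorem lastCoeff_append (i : Bool) (L : List (M × (Bool → B))) {L' : List (M × (Bool → B))}
    (h : L' ≠ []) : lastCoeff i (L ++ L') = lastCoeff i L' := by
  obtain ⟨L', p, rfl⟩ : ∃ l a, L' = l ++ [a] := by
    simpa [List.concat_eq_append] using (List.eq_nil_or_concat L').resolve_left h
  rw [← List.append_assoc, lastCoeff_concat, lastCoeff_concat]

theorem lastCoeff_congr (i : Bool) (U V : List (M × (Bool → B))) (n n' : M) (β : Bool → B) :
    lastCoeff i (U ++ (n, β) :: V) = lastCoeff i (U ++ (n', β) :: V) := by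
  rcases V with _ | ⟨p, V⟩
  · simp [lastCoeff_concat]
  · rw [List.append_cons U (n, β), List.append_cons U (n', β),
      lastCoeff_append _ (U ++ [(n, β)]) (by simp), lastCoeff_append _ (U ++ [(n', β)]) (by simp)]

/-- A pair of values of the form `d eᵢ` with the same `d ∈ D`. -/
def IsScalarMultiple (hDB : D ≤ B) (e β : Bool → B) : Prop :=
  ∃ d : D, ∀ i, β i = Subalgebra.inclusion hDB d * e i

theorem IsScalarMultiple.add {hDB : D ≤ B} {e β β' : Bool → B} (h : IsScalarMultiple hDB e β)
    (h' : IsScalarMultiple hDB e β') : IsScalarMultiple hDB e (fun i => β i + β' i) := by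
  obtain ⟨d, hd⟩ := h
  obtain ⟨d', hd'⟩ := h'
  exact ⟨d + d', fun i => by simp only [hd, hd', map_add, add_mul]⟩

theorem IsScalarMultiple.sub {hDB : D ≤ B} {e β β' : Bool → B} (h : IsScalarMultiple hDB e β)
    (h' : IsScalarMultiple hDB e β') : IsScalarMultiple hDB e (fun i => β i - β' i) := by
  obtain ⟨d, hd⟩ := h
  obtain ⟨d', hd'⟩ := h'
  exact ⟨d - d', fun i => by simp only [hd, hd', map_sub, sub_mul]⟩

theorem IsScalarMultiple.zero (hDB : D ≤ B) (e : Bool → B) :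
    IsScalarMultiple hDB e (fun _ => 0) := ⟨0, fun i => by simp⟩

theorem IsScalarMultiple.congr {hDB : D ≤ B} {e e' β β' : Bool → B}
    (h : IsScalarMultiple hDB e β) (he : ∀ i, e i = e' i) (hβ : ∀ i, β i = β' i) :
    IsScalarMultiple hDB e' β' := by
  obtain ⟨d, hd⟩ := h
  exact ⟨d, fun i => by rw [← hβ, ← he, hd]⟩

/-- The elements lie in `T` and the coefficients agree under `F`. -/
def IsBalanced (F : B →ₗ[ℂ] D) (T : Set M) (L : List (M × (Bool → B))) : Prop :=
  ∀ p ∈ L, p.1 ∈ T ∧ ∀ i j, F (p.2 i) = F (p.2 j)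

/-- The cumulant of the letters is an element of `D` times the last coefficient, where the
element of `D` does not depend on the choice of the coefficients. -/
def HasScalarCumulant (hDB : D ≤ B) (E : M →ₗ[ℂ] B) (L : List (M × (Bool → B))) : Prop :=
  IsScalarMultiple hDB (fun i => lastCoeff i L) (fun i => cumulantMap E (letters i L))

/-- The cumulants `{n₁ b₁, …, nₖ₋₁ bₖ₋₁, nₖ}` of elements of `T` are in `D` and depend only
on `F b₁, …, F bₖ₋₁`. -/
def ScalarCumulants (hDB : D ≤ B) (E : M →ₗ[ℂ] B) (F : B →ₗ[ℂ] D) (T : Set M) : Prop :=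
  ∀ L : List (M × (Bool → B)), L ≠ [] → IsBalanced F T L → HasScalarCumulant hDB E L

theorem ScalarCumulants.mono {hDB : D ≤ B} {E : M →ₗ[ℂ] B} {F : B →ₗ[ℂ] D} {T T' : Set M}
    (h : ScalarCumulants hDB E F T') (hT : T ⊆ T') : ScalarCumulants hDB E F T :=
  fun L hL hb => h L hL fun p hp => ⟨hT (hb p hp).1, (hb p hp).2⟩

theorem isBalanced_append {F : B →ₗ[ℂ] D} {T : Set M} {L L' : List (M × (Bool → B))} :
    IsBalanced F T (L ++ L') ↔ IsBalanced F T L ∧ IsBalanced F T L' := by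
  simp only [IsBalanced, List.forall_mem_append]

theorem isBalanced_cons {F : B →ₗ[ℂ] D} {T : Set M} {p : M × (Bool → B)}
    {L : List (M × (Bool → B))} : IsBalanced F T (p :: L) ↔
      (p.1 ∈ T ∧ ∀ i j, F (p.2 i) = F (p.2 j)) ∧ IsBalanced F T L := by
  simp [IsBalanced]

theorem isBalanced_nil {F : B →ₗ[ℂ] D} {T : Set M} :
    IsBalanced F T ([] : List (M × (Bool → B))) := by
  simp [IsBalanced]

theorem map_inclusion_mul {hDB : D ≤ B} {F : B →ₗ[ℂ] D}
    (hF : IsCondExp (Subalgebra.inclusion hDB) F) (d : D) (b : B) :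
    F (Subalgebra.inclusion hDB d * b) = d * F b := by
  simpa using hF.map_bilinear d 1 b

theorem map_mul_inclusion {hDB : D ≤ B} {F : B →ₗ[ℂ] D}
    (hF : IsCondExp (Subalgebra.inclusion hDB) F) (b : B) (d : D) :
    F (b * Subalgebra.inclusion hDB d) = F b * d := by
  simpa using hF.map_bilinear 1 d b

theorem map_inclusion {hDB : D ≤ B} {F : B →ₗ[ℂ] D}
    (hF : IsCondExp (Subalgebra.inclusion hDB) F) (d : D) :
    F (Subalgebra.inclusion hDB d) = d := by
  simpa [hF.map_one] using map_inclusion_mul hF d 1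

/-- The total weight of the elements of a list. -/
def weight (μ : M → ℕ) (L : List (M × (Bool → B))) : ℕ := (L.map fun p => μ p.1).sum

theorem weight_append (μ : M → ℕ) (L L' : List (M × (Bool → B))) :
    weight μ (L ++ L') = weight μ L + weight μ L' := by
  simp [weight]

theorem weight_cons (μ : M → ℕ) (p : M × (Bool → B)) (L : List (M × (Bool → B))) :
    weight μ (p :: L) = μ p.1 + weight μ L := by
  simp [weight]

theorem weight_nil (μ : M → ℕ) : weight μ ([] : List (M × (Bool → B))) = 0 := rfl

/-! ### Scalar cumulants and the product formula -/

section Nested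

variable {hDB : D ≤ B} {E : M →ₗ[ℂ] B} {F : B →ₗ[ℂ] D} {T : Set M} {μ : M → ℕ} {k : ℕ}

/-- The inner cumulant is `d` times its last coefficient, with `d` independent of the system. By
left `D`-linearity of `F` it is again an admissible coefficient, and the outer cumulant is covered
by `hJ`. -/
theorem isScalarMultiple_nestRight (hF : IsCondExp (Subalgebra.inclusion hDB) F)
    (hJ : ∀ L : List (M × (Bool → B)), L ≠ [] → IsBalanced F T L → weight μ L < k →
      HasScalarCumulant hDB E L)
    {x : M} (hx : x ∈ T) {U : List (M × (Bool → B))} (hU : IsBalanced F T U)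
    (Y R : List (M × (Bool → B))) (hR : IsBalanced F T R) (hY : IsBalanced F T Y)
    (h1 : weight μ U + μ x + weight μ Y.tail < k) (h2 : weight μ R + weight μ Y < k) :
    IsScalarMultiple hDB (fun i => lastCoeff i (R ++ Y))
      (fun i => nestRight E x (letters i U) (letters i R) (letters i Y)) := by
  induction Y generalizing R with
  | nil => exact IsScalarMultiple.zero _ _
  | cons z Y ih =>
    rw [isBalanced_cons] at hY
    simp only [List.tail_cons, weight_cons] at h1 h2
    have hRz : IsBalanced F T (R ++ [z]) := by
      rw [isBalanced_append, isBalanced_cons]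
      exact ⟨hR, hY.1, isBalanced_nil⟩
    obtain ⟨d, hd⟩ := hJ (R ++ [z]) (by simp) hRz
      (by rw [weight_append, weight_cons, weight_nil]; omega)
    simp only [lastCoeff_concat] at hd
    have hout := hJ (U ++ [(x, fun i => cumulantMap E (letters i (R ++ [z])))] ++ Y) (by simp)
      (by
        rw [isBalanced_append, isBalanced_append, isBalanced_cons]
        refine ⟨⟨hU, ⟨hx, fun i j => ?_⟩, isBalanced_nil⟩, hY.2⟩
        simp only [hd, map_inclusion_mul hF, hY.1.2 i j])
      (by simp only [weight_append, weight_cons, weight_nil]; omega)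
    have hterm : IsScalarMultiple hDB (fun i => lastCoeff i (R ++ z :: Y))
        (fun i => cumulantMap E (letters i U ++
          [x * (cumulantMap E (letters i R ++ [z.1 * (z.2 i : M)]) : M)] ++ letters i Y)) := by
      rcases eq_or_ne Y [] with rfl | hne
      -- With nothing behind the inner cumulant, it is itself the last coefficient, and the scalars
      -- multiply to `d' * d`.
      · obtain ⟨d', hd'⟩ := hout
        refine ⟨d' * d, fun i => ?_⟩
        have := hd' i
        simp only [List.append_nil, lastCoeff_concat, hd] at this
        simp only [lastCoeff_concat, map_mul, mul_assoc, ← this]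
        simp [letters, ← hd]
      · refine hout.congr (fun i => ?_) (fun i => ?_)
        · rw [lastCoeff_append _ _ hne, List.append_cons, lastCoeff_append _ _ hne]
        · simp [letters]
    have hrest := ih (R ++ [z]) hRz hY.2 (by
      have : weight μ Y.tail ≤ weight μ Y := by
        cases Y with
        | nil => simp
        | cons p Y => rw [List.tail_cons, weight_cons]; omega
      omega) (by rw [weight_append, weight_cons, weight_nil]; omega)
    refine (hterm.add (hrest.congr (fun i => ?_) (fun i => rfl))).congr (fun i => rfl) (fun i => ?_)
    · rw [List.append_assoc, List.singleton_append]
    · simp [letters, nestRight]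

/-- The inner cumulant ends in `x` with coefficient `1`, so it is an element of `D` common to both
systems. Multiplying it to the coefficient of `z` is harmless by right `D`-linearity of `F`. -/
theorem isScalarMultiple_nestLeft (hF : IsCondExp (Subalgebra.inclusion hDB) F)
    (hJ : ∀ L : List (M × (Bool → B)), L ≠ [] → IsBalanced F T L → weight μ L < k →
      HasScalarCumulant hDB E L)
    {x : M} (hx : x ∈ T) {Y : List (M × (Bool → B))} (hY : IsBalanced F T Y) (hYne : Y ≠ [])
    (R P : List (M × (Bool → B))) (hR : IsBalanced F T R) (hP : IsBalanced F T P)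
    (h1 : weight μ R + μ x < k) (h2 : weight μ P + weight μ R + weight μ Y < k) :
    IsScalarMultiple hDB (fun i => lastCoeff i Y)
      (fun i => nestLeft E (fun U => cumulantMap E (U ++ letters i Y)) x
        (letters i P) (letters i R)) := by
  induction R generalizing P with
  | nil => exact IsScalarMultiple.zero _ _
  | cons z R ih =>
    rw [isBalanced_cons] at hR
    simp only [weight_cons] at h1 h2
    obtain ⟨d, hd⟩ := hJ (R ++ [(x, fun _ => 1)]) (by simp)
      (by
        rw [isBalanced_append, isBalanced_cons]
        exact ⟨hR.2, ⟨hx, fun i j => rfl⟩, isBalanced_nil⟩)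
      (by rw [weight_append, weight_cons, weight_nil]; simp only; omega)
    simp only [lastCoeff_concat, mul_one] at hd
    have hout := hJ (P ++ [(z.1, fun i => z.2 i * cumulantMap E (letters i (R ++ [(x, fun _ => 1)])))]
        ++ Y) (by simp)
      (by
        rw [isBalanced_append, isBalanced_append, isBalanced_cons]
        refine ⟨⟨hP, ⟨hR.1.1, fun i j => ?_⟩, isBalanced_nil⟩, hY⟩
        simp only [hd, map_mul_inclusion hF, hR.1.2 i j])
      (by simp only [weight_append, weight_cons, weight_nil]; omega)
    have hrest := ih (P ++ [z]) hR.2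
      (by
        rw [isBalanced_append, isBalanced_cons]
        exact ⟨hP, hR.1, isBalanced_nil⟩)
      (by omega) (by rw [weight_append, weight_cons, weight_nil]; omega)
    refine IsScalarMultiple.congr (hout.congr (e' := fun i => lastCoeff i Y)
      (fun i => lastCoeff_append _ _ hYne) (fun i => rfl) |>.add hrest) (fun i => rfl) (fun i => ?_)
    simp [letters, nestLeft, mul_assoc]

theorem isScalarMultiple_product_sub (hE : IsCondExp B.val E)
    (hF : IsCondExp (Subalgebra.inclusion hDB) F)
    (hJ : ∀ L : List (M × (Bool → B)), L ≠ [] → IsBalanced F T L → weight μ L < k →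
      HasScalarCumulant hDB E L)
    {x y : M} (hx : x ∈ T) (hy : y ∈ T) {β : Bool → B} (hβ : ∀ i j, F (β i) = F (β j))
    {U V : List (M × (Bool → B))} (hU : IsBalanced F T U) (hV : IsBalanced F T V)
    (h1 : weight μ U + μ x + weight μ V < k) (h2 : weight μ U + μ y + weight μ V < k) :
    IsScalarMultiple hDB (fun i => lastCoeff i ((y, β) :: V))
      (fun i => cumulantMap E (letters i (U ++ (x * y, β) :: V)) -
        cumulantMap E (letters i (U ++ (x, fun _ => 1) :: (y, β) :: V))) := by
  have hY : IsBalanced F T ((y, β) :: V) := isBalanced_cons.2 ⟨⟨hy, hβ⟩, hV⟩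
  have hr := isScalarMultiple_nestRight (E := E) hF hJ hx hU ((y, β) :: V) [] isBalanced_nil hY h1
    (by simp only [weight_cons, weight_nil]; omega)
  have hl := isScalarMultiple_nestLeft (E := E) hF hJ hx hY (by simp) U [] hU isBalanced_nil
    (by omega) (by simp only [weight_cons, weight_nil]; omega)
  refine (hr.add hl).congr (fun i => rfl) (fun i => ?_)
  have := cumulantMap_product hE (letters i U) (letters i V) x (y * (β i : M))
  simp only [letters_append, letters_cons, Subalgebra.coe_one, mul_one, mul_assoc, this]
  simp only [letters, List.map_nil]
  abel

/-- The two cumulants differ by nested terms built from cumulants of weight below `k`. The weight is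
left open: it counts the occurrences of a new element when the set is enlarged, and the length when
the converse is proved. -/
theorem hasScalarCumulant_product (hE : IsCondExp B.val E)
    (hF : IsCondExp (Subalgebra.inclusion hDB) F)
    (hJ : ∀ L : List (M × (Bool → B)), L ≠ [] → IsBalanced F T L → weight μ L < k →
      HasScalarCumulant hDB E L)
    {x y : M} (hx : x ∈ T) (hy : y ∈ T) {β : Bool → B} (hβ : ∀ i j, F (β i) = F (β j))
    {U V : List (M × (Bool → B))} (hU : IsBalanced F T U) (hV : IsBalanced F T V)
    (h1 : weight μ U + μ x + weight μ V < k) (h2 : weight μ U + μ y + weight μ V < k) :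
    HasScalarCumulant hDB E (U ++ (x * y, β) :: V) ↔
      HasScalarCumulant hDB E (U ++ (x, fun _ => 1) :: (y, β) :: V) := by
  have h := isScalarMultiple_product_sub hE hF hJ hx hy hβ hU hV h1 h2
  have e1 : ∀ i, lastCoeff i (U ++ (x, fun _ => 1) :: (y, β) :: V) = lastCoeff i ((y, β) :: V) :=
    fun i => by rw [List.append_cons, lastCoeff_append _ _ (by simp)]
  have e2 : ∀ i, lastCoeff i (U ++ (x * y, β) :: V) = lastCoeff i ((y, β) :: V) :=
    fun i => by rw [lastCoeff_congr i U V (x * y) y, lastCoeff_append _ _ (by simp)]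
  constructor
  · intro hm
    exact ((hm.congr e2 (fun _ => rfl)).sub h).congr (fun i => (e1 i).symm) (fun i => by simp)
  · intro hs
    exact ((hs.congr e1 (fun _ => rfl)).add h).congr (fun i => (e2 i).symm) (fun i => by simp)

end Nested

end ScalarCumulants

/-! ### From generators to the generated algebra -/

section Freeness

variable {M : Type*} [Ring M] [Algebra ℂ M] {B D : Subalgebra ℂ M}

theorem IsCondExp.comp {hDB : D ≤ B} {E : M →ₗ[ℂ] B} {F : B →ₗ[ℂ] D} (hE : IsCondExp B.val E)
    (hF : IsCondExp (Subalgebra.inclusion hDB) F) : IsCondExp D.val (F ∘ₗ E) where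
  map_one := by simp [hE.map_one, hF.map_one]
  map_bilinear d d' m := by
    have := hE.map_bilinear (Subalgebra.inclusion hDB d) (Subalgebra.inclusion hDB d') m
    rw [LinearMap.comp_apply, LinearMap.comp_apply, ← hF.map_bilinear, ← this]
    rfl

/-- Induction on the number of occurrences of `z`. A sum is split by additivity; a product is split
by the product formula, whose nested terms also contain `z` less often. -/
theorem ScalarCumulants.insert {hDB : D ≤ B} {E : M →ₗ[ℂ] B} {F : B →ₗ[ℂ] D}
    (hE : IsCondExp B.val E) (hF : IsCondExp (Subalgebra.inclusion hDB) F) {T : Set M}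
    (h : ScalarCumulants hDB E F T) {x y z : M} (hx : x ∈ T) (hy : y ∈ T)
    (hz : z = x + y ∨ z = x * y) : ScalarCumulants hDB E F (insert z T) := by
  classical
  by_cases hzT : z ∈ T
  · rwa [Set.insert_eq_of_mem hzT]
  set μ : M → ℕ := fun n => if n = z then 1 else 0 with hμ
  have hμx : μ x = 0 := if_neg fun hxz : x = z => hzT (hxz ▸ hx)
  have hμy : μ y = 0 := if_neg fun hyz : y = z => hzT (hyz ▸ hy)
  have hμz : μ z = 1 := if_pos rfl
  intro L
  induction hk : weight μ L using Nat.strong_induction_on generalizing L with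
  | _ k ih =>
    intro hL hb
    by_cases hzL : ∃ p ∈ L, p.1 = z
    · obtain ⟨⟨z', β⟩, hp, rfl⟩ := hzL
      obtain ⟨U, V, rfl⟩ := List.append_of_mem hp
      rw [isBalanced_append, isBalanced_cons] at hb
      obtain ⟨hU, ⟨-, hβ⟩, hV⟩ := hb
      simp only [weight_append, weight_cons] at hk
      simp only at hμz
      have hx' : x ∈ Insert.insert z' T := Set.mem_insert_of_mem _ hx
      have hy' : y ∈ Insert.insert z' T := Set.mem_insert_of_mem _ hy
      have hb1 : ∀ n ∈ Insert.insert z' T, IsBalanced F (Insert.insert z' T) (U ++ (n, β) :: V) :=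
        fun n hn => by
          rw [isBalanced_append, isBalanced_cons]
          exact ⟨hU, ⟨hn, hβ⟩, hV⟩
      rcases hz with hz | hz
      · simp only at hz
        have h1 := ih _ (by simp only [weight_append, weight_cons]; omega) (U ++ (x, β) :: V) rfl
          (by simp) (hb1 x hx')
        have h2 := ih _ (by simp only [weight_append, weight_cons]; omega) (U ++ (y, β) :: V) rfl
          (by simp) (hb1 y hy')
        refine ((h1.congr (fun i => lastCoeff_congr i U V x z' β) (fun _ => rfl)).add
          (h2.congr (fun i => lastCoeff_congr i U V y z' β) (fun _ => rfl))).congr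
          (fun _ => rfl) (fun i => ?_)
        simp only [letters_append, letters_cons, hz, add_mul,
          (isAdditiveBracket_cumulantMap hE).add]
      · simp only at hz
        have h3 : HasScalarCumulant hDB E (U ++ (x * y, β) :: V) := by
          rw [hasScalarCumulant_product (μ := μ) (k := k) hE hF
            (fun L hL hb hw => ih _ hw L rfl hL hb) hx' hy' hβ hU hV (by omega) (by omega)]
          refine ih _ ?_ _ rfl (by simp) ?_
          · simp only [weight_append, weight_cons]; omega
          · rw [isBalanced_append, isBalanced_cons, isBalanced_cons]
            exact ⟨hU, ⟨hx', fun _ _ => rfl⟩, ⟨hy', hβ⟩, hV⟩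
        rwa [← hz] at h3
    · exact h L hL fun p hp => ⟨((hb p hp).1).resolve_left fun h => hzL ⟨p, hp, h⟩, (hb p hp).2⟩

/-- A letter from `D` makes every cumulant of order at least two vanish, and a cumulant of order one
is the letter `d * β` itself. -/
theorem ScalarCumulants.union_scalars {hDB : D ≤ B} {E : M →ₗ[ℂ] B} {F : B →ₗ[ℂ] D}
    (hE : IsCondExp B.val E) {T : Set M} (h : ScalarCumulants hDB E F T) :
    ScalarCumulants hDB E F (T ∪ D) := by
  intro L hL hb
  by_cases hD : ∃ p ∈ L, p.1 ∈ D
  · obtain ⟨⟨d, β⟩, hp, hd⟩ := hD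
    have hmem : ∀ i, ((Subalgebra.inclusion hDB ⟨d, hd⟩ * β i : B) : M) ∈ letters i L :=
      fun i => List.mem_map.2 ⟨_, hp, rfl⟩
    by_cases hlen : 2 ≤ L.length
    · refine (IsScalarMultiple.zero hDB _).congr (fun _ => rfl) (fun i => ?_)
      exact (cumulantMap_eq_zero_of_coe_mem hE (by simpa [letters] using hlen) (hmem i)).symm
    · obtain ⟨q, rfl⟩ : ∃ q, L = [q] := by
        rw [← List.length_eq_one_iff]
        have := List.length_pos_iff.2 hL
        omega
      obtain rfl : (d, β) = q := by simpa using hp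
      refine ⟨⟨d, hd⟩, fun i => ?_⟩
      have := hE.map_coe (Subalgebra.inclusion hDB ⟨d, hd⟩ * β i)
      simp only [letters, List.map_cons, List.map_nil, cumulantMap_singleton hE]
      exact this
  · exact h L hL fun p hp => ⟨((hb p hp).1).resolve_right fun h => hD ⟨p, hp, h⟩, (hb p hp).2⟩

theorem ScalarCumulants.adjoin {hDB : D ≤ B} {E : M →ₗ[ℂ] B} {F : B →ₗ[ℂ] D}
    (hE : IsCondExp B.val E) (hF : IsCondExp (Subalgebra.inclusion hDB) F) {S : Set M}
    (h : ScalarCumulants hDB E F S) :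
    ScalarCumulants hDB E F (Algebra.adjoin ℂ ((D : Set M) ∪ S) : Subalgebra ℂ M) := by
  -- Take a maximal set with scalar cumulants that contains `S` and `D`. Unions of chains are
  -- admissible because a list has finitely many entries. By maximality `T` is closed under sums and
  -- products, so it is a subalgebra.
  obtain ⟨T, hST, hT⟩ := zorn_subset_nonempty {T | ScalarCumulants hDB E F T} (by
    intro c hc hchain hne
    refine ⟨⋃₀ c, ?_, fun s hs => Set.subset_sUnion_of_mem hs⟩
    intro L hL hb
    have : ∀ L : List (M × (Bool → B)), (∀ p ∈ L, p.1 ∈ ⋃₀ c) → ∃ T ∈ c, ∀ p ∈ L, p.1 ∈ T := by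
      intro L
      induction L with
      | nil => exact fun _ => ⟨hne.some, hne.some_mem, by simp⟩
      | cons p L ih =>
        intro hp
        rw [List.forall_mem_cons] at hp
        obtain ⟨T, hTc, hT⟩ := ih hp.2
        obtain ⟨T', hTc', hT'⟩ := hp.1
        rcases hchain.total hTc hTc' with hle | hle
        · exact ⟨T', hTc', List.forall_mem_cons.2 ⟨hT', fun p hp => hle (hT p hp)⟩⟩
        · exact ⟨T, hTc, List.forall_mem_cons.2 ⟨hle hT', hT⟩⟩
    obtain ⟨T, hTc, hT⟩ := this L fun p hp => (hb p hp).1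
    exact hc hTc L hL fun p hp => ⟨hT p hp, (hb p hp).2⟩) (S ∪ D) (h.union_scalars hE)
  have hclosed : ∀ {x y z : M}, x ∈ T → y ∈ T → (z = x + y ∨ z = x * y) → z ∈ T :=
    fun hx hy hz => hT.2 (hT.1.insert hE hF hx hy hz) (Set.subset_insert _ _) (Set.mem_insert _ _)
  let A : Subalgebra ℂ M :=
    { carrier := T
      mul_mem' := fun hx hy => hclosed hx hy (Or.inr rfl)
      add_mem' := fun hx hy => hclosed hx hy (Or.inl rfl)
      algebraMap_mem' := fun r => hST (Or.inr (D.algebraMap_mem r)) }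
  have hA : Algebra.adjoin ℂ ((D : Set M) ∪ S) ≤ A :=
    Algebra.adjoin_le (by rw [Set.union_comm]; exact hST)
  exact ScalarCumulants.mono (T' := T) hT.1 hA

theorem cumulantMap_cons_eq_sub {E : M →ₗ[ℂ] B} (hE : IsCondExp B.val E) (a : M) (l : List M) :
    cumulantMap E (a :: l) = E (a * l.prod) -
      blockSum E (closeBlock E (truncBracket (cumulantMap E) (l.length + 1))) [] a 1 l := by
  rw [moment_eq_blockSum hE, ← blockSum_sub]
  have := blockSum_closeBlock_eq_full hE (fun q => cumulantMap E q -
    truncBracket (cumulantMap E) (l.length + 1) q) a l (fun q _ hq => by simp [truncBracket, hq])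
  simp only [truncBracket, List.length_cons, lt_irrefl, if_false, sub_zero] at this
  rw [← this]
  rfl

/-- Since `D ≤ N`, closing a gap inside `N` produces an entry that is again in `N`, so the two
recursions never leave the algebra on which the expectations agree. -/
theorem blockSum_eq_of_scalar {E : M →ₗ[ℂ] B} {φ : M →ₗ[ℂ] D} {N : Subalgebra ℂ M} (hDN : D ≤ N)
    (hN : ∀ n ∈ N, (E n : M) = φ n) {κ : List M → B} {κ' : List M → D}
    (hκ : ∀ q, q ≠ [] → (∀ m ∈ q, m ∈ N) → (κ q : M) = κ' q) (p : List M) (a y : M) (l : List M)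
    (hp : ∀ m ∈ p, m ∈ N) (ha : a ∈ N) (hy : y ∈ N) (hl : ∀ m ∈ l, m ∈ N) :
    (blockSum E (closeBlock E κ) p a y l : M) = blockSum φ (closeBlock φ κ') p a y l := by
  have hclosed : ∀ {p : List M} {a y : M}, (∀ m ∈ p, m ∈ N) → a ∈ N → y ∈ N →
      ∀ m ∈ p ++ [a * (φ y : M)], m ∈ N := by
    intro p a y hp ha hy m hm
    rcases List.mem_append.1 hm with hm | hm
    · exact hp m hm
    · rw [List.mem_singleton.1 hm]
      exact N.mul_mem ha (hDN (φ y).2)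
  induction l generalizing p a y with
  | nil =>
    simp only [blockSum, closeBlock, hN y hy]
    exact hκ _ (by simp) (hclosed hp ha hy)
  | cons x l ih =>
    rw [List.forall_mem_cons] at hl
    simp only [blockSum, Subalgebra.coe_add, hN y hy]
    rw [ih p a (y * x) hp ha (N.mul_mem hy hl.1) hl.2,
      ih _ x 1 (hclosed hp ha hy) hl.1 N.one_mem hl.2]

/-- On a subalgebra on which two conditional expectations agree, their cumulants agree. -/
theorem cumulantMap_eq_of_scalar {E : M →ₗ[ℂ] B} {φ : M →ₗ[ℂ] D} (hE : IsCondExp B.val E)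
    (hφ : IsCondExp D.val φ) {N : Subalgebra ℂ M} (hDN : D ≤ N)
    (hN : ∀ n ∈ N, (E n : M) = φ n) (l : List M) (hl : l ≠ []) (hlN : ∀ m ∈ l, m ∈ N) :
    (cumulantMap E l : M) = cumulantMap φ l := by
  induction hn : l.length using Nat.strong_induction_on generalizing l with
  | _ n ih =>
    obtain ⟨a, l, rfl⟩ := List.exists_cons_of_ne_nil hl
    rw [List.forall_mem_cons] at hlN
    rw [cumulantMap_cons_eq_sub hE, cumulantMap_cons_eq_sub hφ, Subalgebra.coe_sub,
      Subalgebra.coe_sub, hN _ (N.mul_mem hlN.1 (N.list_prod_mem hlN.2))]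
    congr 1
    refine blockSum_eq_of_scalar hDN hN (fun q hq hqN => ?_) [] a 1 l (by simp) hlN.1 N.one_mem hlN.2
    simp only [truncBracket]
    split_ifs with hlt
    · exact ih q.length (by simp at hn; omega) q hq hqN rfl
    · rfl

/-! ### Centred words -/

/-- The letters `n b` of a list of pairs. -/
def pairLetters (L : List (M × B)) : List M := L.map fun p => p.1 * (p.2 : M)

/-- Words `n₁ b₁ ⋯ nₖ bₖ` with centred `nᵢ ∈ N` and, except for the last one, centred `bᵢ`. -/
structure IsCentredWord (E : M →ₗ[ℂ] B) (F : B →ₗ[ℂ] D) (N : Subalgebra ℂ M)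
    (L : List (M × B)) : Prop where
  ne_nil : L ≠ []
  fst : ∀ p ∈ L, p.1 ∈ N ∧ F (E p.1) = 0
  snd : ∀ p ∈ L.dropLast, F p.2 = 0

/-- `E` vanishes on centred words. -/
def CentredMomentsVanish (E : M →ₗ[ℂ] B) (F : B →ₗ[ℂ] D) (N : Subalgebra ℂ M) : Prop :=
  ∀ L : List (M × B), IsCentredWord E F N L → E (pairLetters L).prod = 0

theorem dropLast_subset_of_infix {α : Type*} {l l' : List α} (h : l' <:+: l) :
    l'.dropLast ⊆ l.dropLast := by
  obtain ⟨s, t, rfl⟩ := h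
  rcases eq_or_ne t [] with rfl | ht
  · rcases eq_or_ne l' [] with rfl | hl
    · simp
    · rw [List.append_nil, List.dropLast_append_of_ne_nil hl]
      exact List.subset_append_right _ _
  · rw [List.dropLast_append_of_ne_nil ht]
    intro x hx
    simp [List.dropLast_subset _ hx]

theorem IsCentredWord.infix {E : M →ₗ[ℂ] B} {F : B →ₗ[ℂ] D} {N : Subalgebra ℂ M}
    {L L' : List (M × B)} (h : IsCentredWord E F N L) (hL : L' <:+: L) (hne : L' ≠ []) :
    IsCentredWord E F N L' :=
  ⟨hne, fun p hp => h.fst p (hL.subset hp), fun p hp => h.snd p (dropLast_subset_of_infix hL hp)⟩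

/-- Every run of consecutive letters behind the first one is a shorter centred word, so all gaps
have vanishing moments. -/
theorem IsCentredWord.moment_eq_cumulantMap {E : M →ₗ[ℂ] B} {F : B →ₗ[ℂ] D} {N : Subalgebra ℂ M}
    (hE : IsCondExp B.val E) {L : List (M × B)} (h : IsCentredWord E F N L)
    (h0 : ∀ L' : List (M × B), L'.length < L.length → IsCentredWord E F N L' →
      E (pairLetters L').prod = 0) :
    E (pairLetters L).prod = cumulantMap E (pairLetters L) := by
  obtain ⟨p, L, rfl⟩ := List.exists_cons_of_ne_nil h.ne_nil
  rw [pairLetters, List.map_cons, List.prod_cons]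
  refine moment_eq_cumulantMap_of_infix hE _ _ fun g hg hgl => ?_
  obtain ⟨s, t, hst⟩ := hgl
  obtain ⟨L₁, L₂, hL, h1, -⟩ := List.map_eq_append_iff.1 hst.symm
  obtain ⟨L₃, L₄, rfl, -, rfl⟩ := List.map_eq_append_iff.1 h1
  have hinf : L₄ <:+: L := ⟨L₃, L₂, hL.symm⟩
  have hne : L₄ ≠ [] := by
    rintro rfl
    exact hg rfl
  exact h0 L₄ (Nat.lt_succ_of_le hinf.length_le)
    (h.infix (hinf.trans (List.suffix_cons p L).isInfix) hne)

/-- The system with a zero letter has vanishing cumulant. As the last coefficients agree, the common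
scalar gives both systems the same cumulant. -/
theorem HasScalarCumulant.cumulantMap_eq_zero {hDB : D ≤ B} {E : M →ₗ[ℂ] B}
    (hE : IsCondExp B.val E) {L : List (M × (Bool → B))} (h : HasScalarCumulant hDB E L)
    (h0 : (0 : M) ∈ letters true L) (hlast : lastCoeff false L = lastCoeff true L) :
    cumulantMap E (letters false L) = 0 := by
  obtain ⟨d, hd⟩ := h
  have h1 := hd true
  have h2 := hd false
  simp only at h1 h2
  rw [h2, hlast, ← h1, cumulantMap_eq_zero_of_mem hE h0]

/-- Keeping the coefficient and replacing it by zero. -/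
def withZero (p : M × B) : M × (Bool → B) := (p.1, fun i => cond i 0 p.2)

/-- Keeping the coefficient. -/
def withConst (p : M × B) : M × (Bool → B) := (p.1, fun _ => p.2)

theorem letters_false_withZero (L : List (M × B)) :
    letters false (L.map withZero) = pairLetters L := by
  simp [letters, pairLetters, withZero]

theorem letters_withConst (i : Bool) (L : List (M × B)) :
    letters i (L.map withConst) = pairLetters L := by
  simp [letters, pairLetters, withConst]

theorem isBalanced_withConst {F : B →ₗ[ℂ] D} {T : Set M} {L : List (M × B)}
    (h : ∀ p ∈ L, p.1 ∈ T) : IsBalanced F T (L.map withConst) := by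
  intro p hp
  obtain ⟨q, hq, rfl⟩ := List.mem_map.1 hp
  exact ⟨h q hq, fun _ _ => rfl⟩

theorem isBalanced_withZero {F : B →ₗ[ℂ] D} {T : Set M} {L : List (M × B)}
    (h : ∀ p ∈ L, p.1 ∈ T ∧ F p.2 = 0) : IsBalanced F T (L.map withZero) := by
  intro p hp
  obtain ⟨q, hq, rfl⟩ := List.mem_map.1 hp
  refine ⟨(h q hq).1, fun i j => ?_⟩
  cases i <;> cases j <;> simp [withZero, (h q hq).2]

theorem lastCoeff_withConst (U : List (M × (Bool → B))) {L : List (M × B)} (hL : L ≠ []) :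
    lastCoeff false (U ++ L.map withConst) = lastCoeff true (U ++ L.map withConst) := by
  rw [lastCoeff_append _ _ (by simpa using hL), lastCoeff_append _ _ (by simpa using hL)]
  simp [lastCoeff, withConst, Function.comp_def]

theorem ScalarCumulants.coe_eq {hDB : D ≤ B} {E : M →ₗ[ℂ] B} {F : B →ₗ[ℂ] D}
    (hE : IsCondExp B.val E) (hF : IsCondExp (Subalgebra.inclusion hDB) F) {T : Set M}
    (h : ScalarCumulants hDB E F T) {n : M} (hn : n ∈ T) :
    E n = Subalgebra.inclusion hDB (F (E n)) := by
  obtain ⟨d, hd⟩ := h [(n, fun _ => 1)] (by simp) (by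
    rw [isBalanced_cons]; exact ⟨⟨hn, fun _ _ => rfl⟩, isBalanced_nil⟩)
  have := hd true
  simp only [letters, List.map_cons, List.map_nil, cumulantMap_singleton hE, lastCoeff,
    List.getLast?_singleton, Option.map_some, Option.getD_some, mul_one, Subalgebra.coe_one] at this
  rw [this, map_inclusion hF]

/-- By induction the moment is a cumulant. The first coefficient is centred and may be exchanged for
`0`; for a single letter, `E n` equals its image under `F`, which is `0`. -/
theorem ScalarCumulants.centredMomentsVanish {hDB : D ≤ B} {E : M →ₗ[ℂ] B} {F : B →ₗ[ℂ] D}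
    (hE : IsCondExp B.val E) (hF : IsCondExp (Subalgebra.inclusion hDB) F) {N : Subalgebra ℂ M}
    (h : ScalarCumulants hDB E F N) : CentredMomentsVanish E F N := by
  intro L
  induction hk : L.length using Nat.strong_induction_on generalizing L with
  | _ k ih =>
    intro hL
    rw [hL.moment_eq_cumulantMap hE fun L' hlt hL' => ih _ (hk ▸ hlt) L' rfl hL']
    obtain ⟨p, L, rfl⟩ := List.exists_cons_of_ne_nil hL.ne_nil
    rcases eq_or_ne L [] with rfl | hne
    · have h1 := hL.fst p (by simp)
      have h2 := h.coe_eq hE hF h1.1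
      rw [h1.2, map_zero] at h2
      simp [pairLetters, cumulantMap_singleton hE, hE.map_mul_right, h2]
    · have hp : F p.2 = 0 := hL.snd p (by
        rw [List.dropLast_cons_of_ne_nil hne]; simp)
      have h3 := h ([p].map withZero ++ L.map withConst) (by simp) (by
        rw [isBalanced_append]
        exact ⟨isBalanced_withZero (by simpa using ⟨(hL.fst p (by simp)).1, hp⟩),
          isBalanced_withConst fun q hq => (hL.fst q (by simp [hq])).1⟩)
      have h4 := h3.cumulantMap_eq_zero hE
        (by simp [letters, withZero]) (lastCoeff_withConst _ hne)
      rw [letters_append, letters_false_withZero, letters_withConst] at h4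
      exact h4

theorem weight_one (L : List (M × (Bool → B))) : weight (fun _ => 1) L = L.length := by
  simp [weight]

/-! ### From vanishing centred moments to scalar cumulants -/

section Converse

variable {hDB : D ≤ B} {E : M →ₗ[ℂ] B} {F : B →ₗ[ℂ] D} {N : Subalgebra ℂ M} {k : ℕ}

/-- An entry from `N` with coefficient `1` can be multiplied into its right neighbour, and `N` is
closed under products. The product formula thus reduces the cumulant to shorter ones. -/
theorem HasScalarCumulant.of_shorter (hE : IsCondExp B.val E)
    (hF : IsCondExp (Subalgebra.inclusion hDB) F)
    (hJ : ∀ L : List (M × (Bool → B)), L ≠ [] → IsBalanced F N L → L.length < k →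
      HasScalarCumulant hDB E L) {U V : List (M × (Bool → B))} {x : M}
    (hU : IsBalanced F N U) (hx : x ∈ N) (hV : IsBalanced F N V) (hVne : V ≠ [])
    (hk : U.length + 1 + V.length = k) :
    HasScalarCumulant hDB E (U ++ (x, fun _ => 1) :: V) := by
  obtain ⟨⟨y, β⟩, V, rfl⟩ := List.exists_cons_of_ne_nil hVne
  rw [isBalanced_cons] at hV
  simp only [List.length_cons] at hk
  rw [← hasScalarCumulant_product (μ := fun _ => 1) (k := k) hE hF
    (fun L hL hb hw => hJ L hL hb (by rwa [weight_one] at hw)) hx hV.1.1 hV.1.2 hU hV.2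
    (by simp only [weight_one]; omega) (by simp only [weight_one]; omega)]
  refine hJ _ (by simp) ?_ (by simp; omega)
  rw [isBalanced_append, isBalanced_cons]
  exact ⟨hU, ⟨N.mul_mem hx hV.1.1, hV.1.2⟩, hV.2⟩

theorem centre_mem (hDN : D ≤ N) (n : M) (hn : n ∈ N) : n - (F (E n) : M) ∈ N :=
  N.sub_mem hn (hDN (F (E n)).2)

theorem map_centre (hE : IsCondExp B.val E) (hF : IsCondExp (Subalgebra.inclusion hDB) F) (n : M) :
    F (E (n - (F (E n) : M))) = 0 := by
  have : E (F (E n) : M) = Subalgebra.inclusion hDB (F (E n)) :=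
    hE.map_coe (Subalgebra.inclusion hDB (F (E n)))
  rw [map_sub, map_sub, this, map_inclusion hF, sub_self]

theorem cumulantMap_centre (hE : IsCondExp B.val E) (hDB : D ≤ B) (u v : List M) (n : M) (d : D)
    (b : B) (h : u ++ v ≠ []) : cumulantMap E (u ++ (n * (b : M)) :: v) =
      cumulantMap E (u ++ ((n - (d : M)) * (b : M)) :: v) := by
  have h1 := cumulantMap_coe_entry hE u (Subalgebra.inclusion hDB d * b) v h
  have h2 := (isAdditiveBracket_cumulantMap hE).add u ((n - (d : M)) * (b : M))
    ((Subalgebra.inclusion hDB d * b : B) : M) v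
  rw [h1, add_zero] at h2
  rw [← h2, Subalgebra.coe_mul, Subalgebra.coe_inclusion, ← add_mul, sub_add_cancel]

/-- The centred prefix is extended letter by letter. Splitting the next coefficient into its centred
part and its image under `F`, the first part lengthens the prefix. The second is absorbed into `N`,
where `of_shorter` allows the prefix coefficients to be replaced by `0`. A fully centred word has
cumulant equal to its moment, which vanishes. -/
theorem cumulantMap_eq_zero_of_centred_prefix (hE : IsCondExp B.val E)
    (hF : IsCondExp (Subalgebra.inclusion hDB) F) (hDN : D ≤ N) (hM : CentredMomentsVanish E F N)
    (hJ : ∀ L : List (M × (Bool → B)), L ≠ [] → IsBalanced F N L → L.length < k →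
      HasScalarCumulant hDB E L) (V W : List (M × B)) (hW : W ≠ []) (hV : V ≠ [])
    (hWc : ∀ p ∈ W, p.1 ∈ N ∧ F (E p.1) = 0 ∧ F p.2 = 0) (hVN : ∀ p ∈ V, p.1 ∈ N)
    (hk : W.length + V.length = k) : cumulantMap E (pairLetters W ++ pairLetters V) = 0 := by
  have hWne : ∀ v, pairLetters W ++ v ≠ [] := by simp [pairLetters, hW]
  induction V generalizing W with
  | nil => exact absurd rfl hV
  | cons p V ih =>
    obtain ⟨n, b⟩ := p
    rw [List.forall_mem_cons] at hVN
    have hn := centre_mem (E := E) (F := F) hDN n hVN.1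
    have hn0 := map_centre hE hF n
    rw [pairLetters, pairLetters, List.map_cons, ← pairLetters, ← pairLetters,
      cumulantMap_centre hE hDB _ _ n (F (E n)) b (hWne _)]
    rcases eq_or_ne V [] with rfl | hne
    · have hc : IsCentredWord E F N (W ++ [(n - (F (E n) : M), b)]) := by
        refine ⟨by simp, fun q hq => ?_, fun q hq => ?_⟩
        · rcases List.mem_append.1 hq with hq | hq
          · exact ⟨(hWc q hq).1, (hWc q hq).2.1⟩
          · rw [List.mem_singleton.1 hq]
            exact ⟨hn, hn0⟩
        · rw [List.dropLast_concat] at hq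
          exact (hWc q hq).2.2
      have h1 := hc.moment_eq_cumulantMap hE fun L' _ hL' => hM L' hL'
      rw [hM _ hc] at h1
      rw [h1]
      simp [pairLetters]
    · have hFb : F (b - Subalgebra.inclusion hDB (F b)) = 0 := by
        rw [map_sub, map_inclusion hF, sub_self]
      have h1 := ih (W ++ [(n - (F (E n) : M), b - Subalgebra.inclusion hDB (F b))]) (by simp) hne
        (by
          intro q hq
          rcases List.mem_append.1 hq with hq | hq
          · exact hWc q hq
          · rw [List.mem_singleton.1 hq]
            exact ⟨hn, hn0, hFb⟩) hVN.2 (by simp at hk ⊢; omega) (by simp [pairLetters])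
      have h2 : HasScalarCumulant hDB E (W.map withZero ++
          ((n - (F (E n) : M)) * (F b : M), fun _ => 1) :: V.map withConst) :=
        HasScalarCumulant.of_shorter hE hF hJ
          (isBalanced_withZero fun q hq => ⟨(hWc q hq).1, (hWc q hq).2.2⟩)
          (N.mul_mem hn (hDN (F b).2)) (isBalanced_withConst hVN.2) (by simpa using hne)
          (by simp at hk ⊢; omega)
      -- A non-empty prefix supplies the letter that becomes zero.
      obtain ⟨q, W', rfl⟩ := List.exists_cons_of_ne_nil hW
      have h3 := h2.cumulantMap_eq_zero hE (by simp [letters, withZero])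
        (by rw [List.append_cons]; exact lastCoeff_withConst _ hne)
      rw [letters_append, letters_cons, letters_false_withZero, letters_withConst] at h3
      have h4 := (isAdditiveBracket_cumulantMap hE).add (pairLetters (q :: W'))
        ((n - (F (E n) : M)) * ((b - Subalgebra.inclusion hDB (F b) : B) : M))
        ((n - (F (E n) : M)) * (F b : M)) (pairLetters V)
      rw [← mul_add, Subalgebra.coe_sub, Subalgebra.coe_inclusion, sub_add_cancel] at h4
      rw [h4]
      simp only [pairLetters, List.map_append, List.map_cons, List.map_nil, List.append_assoc,
        Subalgebra.coe_sub, Subalgebra.coe_inclusion, Subalgebra.coe_one, mul_one,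
        List.cons_append, List.nil_append] at h1 h3 ⊢
      rw [h1, h3, add_zero]

/-- If something precedes `n`, its last letter has coefficient `1` and `of_shorter` applies, so `b`
may be exchanged for `0`. If nothing precedes it, centring `n` gives a centred prefix of length one.
-/
theorem cumulantMap_eq_zero_of_scalar_prefix (hE : IsCondExp B.val E)
    (hF : IsCondExp (Subalgebra.inclusion hDB) F) (hDN : D ≤ N) (hM : CentredMomentsVanish E F N)
    (hJ : ∀ L : List (M × (Bool → B)), L ≠ [] → IsBalanced F N L → L.length < k →
      HasScalarCumulant hDB E L) (u : List M) (hu : ∀ m ∈ u, m ∈ N) (n : M) (hn : n ∈ N) (b : B)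
    (hb : F b = 0) (V : List (M × B)) (hV : V ≠ []) (hVN : ∀ p ∈ V, p.1 ∈ N)
    (hk : u.length + 1 + V.length = k) :
    cumulantMap E (u ++ (n * (b : M)) :: pairLetters V) = 0 := by
  rcases List.eq_nil_or_concat u with rfl | ⟨u, x, rfl⟩
  · rw [cumulantMap_centre hE hDB _ _ n (F (E n)) b (by simpa [pairLetters] using hV)]
    exact cumulantMap_eq_zero_of_centred_prefix hE hF hDN hM hJ V [(n - (F (E n) : M), b)]
      (by simp) hV (List.forall_mem_singleton.2 ⟨centre_mem hDN n hn, map_centre hE hF n, hb⟩) hVN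
      (by simp at hk ⊢; omega)
  · rw [List.concat_eq_append] at hu hk ⊢
    have hx : x ∈ N := hu x (by simp)
    have h1 : HasScalarCumulant hDB E ((u.map fun m => (m, 1)).map withConst ++
        (x, fun _ => 1) :: ([(n, b)].map withZero ++ V.map withConst)) := by
      refine HasScalarCumulant.of_shorter hE hF hJ (isBalanced_withConst fun p hp => ?_) hx
        (isBalanced_append.2 ⟨isBalanced_withZero ?_, isBalanced_withConst hVN⟩) (by simp)
        (by simp at hk ⊢; omega)
      · obtain ⟨m, hm, rfl⟩ := List.mem_map.1 hp
        exact hu m (by simp [hm])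
      · simpa using ⟨hn, hb⟩
    have h2 := h1.cumulantMap_eq_zero hE (by simp [letters, withZero]) (by
      rw [List.append_cons, ← List.append_assoc]
      exact lastCoeff_withConst _ hV)
    rw [letters_append, letters_cons, letters_append, letters_withConst, letters_false_withZero,
      letters_withConst] at h2
    simpa [pairLetters, Function.comp_def] using h2

/-- The coefficients are replaced from left to right. Each one already replaced is absorbed into
`N`, so the next centred difference is always preceded by letters from `N`. -/
theorem cumulantMap_eq_scalar_coeff (hE : IsCondExp B.val E)
    (hF : IsCondExp (Subalgebra.inclusion hDB) F) (hDN : D ≤ N) (hM : CentredMomentsVanish E F N)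
    (hJ : ∀ L : List (M × (Bool → B)), L ≠ [] → IsBalanced F N L → L.length < k →
      HasScalarCumulant hDB E L) (q : M × B) (hq : q.1 ∈ N) (L : List (M × B))
    (hL : ∀ p ∈ L, p.1 ∈ N) (u : List M) (hu : ∀ m ∈ u, m ∈ N) (hk : u.length + L.length + 1 = k) :
    cumulantMap E (u ++ (pairLetters L ++ [q.1 * (q.2 : M)])) =
      cumulantMap E (u ++ ((L.map fun p => p.1 * (F p.2 : M)) ++ [q.1 * (q.2 : M)])) := by
  induction L generalizing u with
  | nil => rfl
  | cons p L ih =>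
    rw [List.forall_mem_cons] at hL
    have hFb : F (p.2 - Subalgebra.inclusion hDB (F p.2)) = 0 := by
      rw [map_sub, map_inclusion hF, sub_self]
    have h1 := cumulantMap_eq_zero_of_scalar_prefix hE hF hDN hM hJ u hu p.1 hL.1 _ hFb (L ++ [q])
      (by simp) (by simpa [or_imp, forall_and, hq] using hL.2) (by simp at hk ⊢; omega)
    have hmem : p.1 * (F p.2 : M) ∈ N := N.mul_mem hL.1 (hDN (F p.2).2)
    have h2 := ih hL.2 (u ++ [p.1 * (F p.2 : M)]) (by
      intro m hm
      rcases List.mem_append.1 hm with hm | hm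
      · exact hu m hm
      · rwa [List.mem_singleton.1 hm]) (by simp at hk ⊢; omega)
    have h3 := (isAdditiveBracket_cumulantMap hE).add u
      (p.1 * ((p.2 - Subalgebra.inclusion hDB (F p.2) : B) : M)) (p.1 * (F p.2 : M))
      (pairLetters (L ++ [q]))
    rw [h1, zero_add, ← mul_add, Subalgebra.coe_sub, Subalgebra.coe_inclusion, sub_add_cancel] at h3
    simp only [pairLetters, List.map_append, List.map_cons, List.map_nil, List.append_assoc,
      List.cons_append, List.nil_append] at h2 h3 ⊢
    rw [h3, h2]

theorem CentredMomentsVanish.map_eq (hE : IsCondExp B.val E)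
    (hF : IsCondExp (Subalgebra.inclusion hDB) F) (hDN : D ≤ N) (hM : CentredMomentsVanish E F N)
    {n : M} (hn : n ∈ N) : (E n : M) = (F ∘ₗ E) n := by
  have h := hM [(n - (F (E n) : M), 1)] ⟨by simp,
    List.forall_mem_singleton.2 ⟨centre_mem hDN n hn, map_centre hE hF n⟩, by simp⟩
  have h1 : E (F (E n) : M) = Subalgebra.inclusion hDB (F (E n)) :=
    hE.map_coe (Subalgebra.inclusion hDB (F (E n)))
  simp only [pairLetters, List.map_cons, List.map_nil, Subalgebra.coe_one, mul_one,
    List.prod_singleton, map_sub, h1, sub_eq_zero] at h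
  rw [h]
  rfl

theorem CentredMomentsVanish.scalarCumulants (hE : IsCondExp B.val E)
    (hF : IsCondExp (Subalgebra.inclusion hDB) F) (hDN : D ≤ N)
    (hM : CentredMomentsVanish E F N) : ScalarCumulants hDB E F N := by
  intro L
  induction hk : L.length using Nat.strong_induction_on generalizing L with
  | _ k ih =>
    intro hL hb
    obtain ⟨L, q, rfl⟩ : ∃ l a, L = l ++ [a] := by
      simpa [List.concat_eq_append] using (List.eq_nil_or_concat L).resolve_left hL
    rw [isBalanced_append, isBalanced_cons] at hb
    refine ⟨cumulantMap (F ∘ₗ E) ((L.map fun p => p.1 * (F (p.2 false) : M)) ++ [q.1]),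
      fun i => ?_⟩
    have h1 := cumulantMap_eq_scalar_coeff hE hF hDN hM
      (fun L hL hb hlt => ih _ hlt L rfl hL hb) (q.1, q.2 i) hb.2.1.1
      (L.map fun p => (p.1, p.2 i)) (by
        intro p hp
        obtain ⟨p, hpL, rfl⟩ := List.mem_map.1 hp
        exact (hb.1 p hpL).1) [] (by simp) (by simpa using hk)
    have h2 : (L.map fun p => (p.1, p.2 i)).map (fun p => p.1 * (F p.2 : M)) =
        L.map fun p => p.1 * (F (p.2 false) : M) := by
      rw [List.map_map]
      refine List.map_congr_left fun p hp => ?_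
      simp only [Function.comp_apply, (hb.1 p hp).2 i false]
    have h3 := cumulantMap_eq_of_scalar hE (hE.comp hF) hDN
      (fun n hn => hM.map_eq hE hF hDN hn)
      ((L.map fun p => p.1 * (F (p.2 false) : M)) ++ [q.1]) (by simp) (by
        intro m hm
        rcases List.mem_append.1 hm with hm | hm
        · obtain ⟨p, hp, rfl⟩ := List.mem_map.1 hm
          exact N.mul_mem (hb.1 p hp).1 (hDN (F _).2)
        · rw [List.mem_singleton.1 hm]
          exact hb.2.1.1)
    have h4 : cumulantMap E ((L.map fun p => p.1 * (F (p.2 false) : M)) ++ [q.1]) =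
        Subalgebra.inclusion hDB (cumulantMap (F ∘ₗ E)
          ((L.map fun p => p.1 * (F (p.2 false) : M)) ++ [q.1])) := Subtype.ext h3
    rw [h2] at h1
    simp only [lastCoeff_concat]
    rw [← h4, ← (isAdditiveBracket_cumulantMap hE).mul_right]
    simpa [pairLetters, letters, Function.comp_def] using h1

end Converse

end Freeness

/-! ### Freeness as vanishing of centred moments -/

section MainTheorem

variable {M : Type*} [Ring M] [Algebra ℂ M] {B D : Subalgebra ℂ M}

theorem isFreeOver_iff_list {φ : M →ₗ[ℂ] D} {J : Type*} {A : J → Subalgebra ℂ M} :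
    IsFreeOver φ A ↔ (∀ j, D ≤ A j) ∧ ∀ l : List (J × M), l ≠ [] →
      l.IsChain (fun p q => p.1 ≠ q.1) → (∀ p ∈ l, p.2 ∈ A p.1 ∧ φ p.2 = 0) →
        φ (l.map Prod.snd).prod = 0 := by
  refine and_congr_right fun _ => ⟨fun h l hl hchain hmem => ?_, fun h p j a hj ha h0 => ?_⟩
  · obtain ⟨n, f, rfl⟩ : ∃ (n : ℕ) (f : Fin n → J × M), l = List.ofFn f :=
      ⟨_, l.get, (List.ofFn_get l).symm⟩
    rcases n with _ | p
    · simp at hl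
    rw [List.isChain_ofFn] at hchain
    have hf : ∀ r, f r ∈ List.ofFn f := fun r => List.mem_ofFn.2 ⟨r, rfl⟩
    rw [List.map_ofFn]
    exact h p (fun r => (f r).1) (fun r => (f r).2)
      (fun r => hchain r (Nat.succ_lt_succ r.2)) (fun r => (hmem _ (hf r)).1)
      (fun r => (hmem _ (hf r)).2)
  · have := h (List.ofFn fun r => (j r, a r)) (by simp) (by
        rw [List.isChain_ofFn]
        exact fun i hi => hj ⟨i, Nat.lt_of_succ_lt_succ hi⟩) (by
        intro q hq
        obtain ⟨r, rfl⟩ := List.mem_ofFn.1 hq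
        exact ⟨ha r, h0 r⟩)
    rw [List.map_ofFn] at this
    exact this

/-- The alternating word of a list of pairs. -/
def alternating (L : List (M × B)) : List (Fin 2 × M) :=
  L.flatMap fun p => [(0, p.1), (1, (p.2 : M))]

theorem prod_alternating (L : List (M × B)) :
    ((alternating L).map Prod.snd).prod = (pairLetters L).prod := by
  induction L with
  | nil => rfl
  | cons p L ih =>
    rw [alternating, List.flatMap_cons, ← alternating, List.map_append, List.prod_append, ih]
    simp [pairLetters]

theorem isChain_alternating (L : List (M × B)) (n : M) (t : List (Fin 2 × M))
    (ht : ((0, n) :: t).IsChain fun p q => p.1 ≠ q.1) :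
    (alternating L ++ (0, n) :: t).IsChain fun p q => p.1 ≠ q.1 := by
  have key : ∀ (L : List (M × B)) (m : M),
      ((1, m) :: (alternating L ++ (0, n) :: t)).IsChain fun p q => p.1 ≠ q.1 := by
    intro L
    induction L with
    | nil => exact fun m => List.isChain_cons_cons.2 ⟨by simp, ht⟩
    | cons p L ih =>
      intro m
      rw [alternating, List.flatMap_cons, ← alternating]
      exact List.isChain_cons_cons.2 ⟨by simp, List.isChain_cons_cons.2 ⟨by simp, ih _⟩⟩
  exact (key L 0).tail

variable {hDB : D ≤ B} {E : M →ₗ[ℂ] B} {F : B →ₗ[ℂ] D} {N : Subalgebra ℂ M}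

theorem mem_alternating {L : List (M × B)}
    (hL : ∀ p ∈ L, p.1 ∈ N ∧ F (E p.1) = 0 ∧ F p.2 = 0) (hE : IsCondExp B.val E)
    {q : Fin 2 × M} (hq : q ∈ alternating L) :
    q.2 ∈ (![N, B] : Fin 2 → Subalgebra ℂ M) q.1 ∧ (F ∘ₗ E) q.2 = 0 := by
  obtain ⟨p, hp, hq⟩ := List.mem_flatMap.1 hq
  obtain ⟨h1, h2, h3⟩ := hL p hp
  simp only [List.mem_cons, List.not_mem_nil, or_false] at hq
  rcases hq with rfl | rfl
  · exact ⟨h1, h2⟩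
  · exact ⟨p.2.2, by simp [hE.map_coe, h3]⟩

/-- Only the last coefficient need not be centred. Its centred part gives an alternating word ending
in `B`; its part in `D` comes out on the right and leaves an alternating word ending in `N`. -/
theorem IsFreeOver.map_centredWord (hE : IsCondExp B.val E)
    (hF : IsCondExp (Subalgebra.inclusion hDB) F) (h : IsFreeOver (F ∘ₗ E) ![N, B])
    {L : List (M × B)} (hL : IsCentredWord E F N L) : F (E (pairLetters L).prod) = 0 := by
  rw [isFreeOver_iff_list] at h
  obtain ⟨L, ⟨n, b⟩, rfl⟩ : ∃ l a, L = l ++ [a] := by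
    simpa [List.concat_eq_append] using (List.eq_nil_or_concat L).resolve_left hL.ne_nil
  have hn := hL.fst (n, b) (by simp)
  have hLc : ∀ p ∈ L, p.1 ∈ N ∧ F (E p.1) = 0 ∧ F p.2 = 0 := fun p hp =>
    have h1 := hL.fst p (by simp [hp])
    ⟨h1.1, h1.2, hL.snd p (by simpa using hp)⟩
  have hb0 : F (b - Subalgebra.inclusion hDB (F b)) = 0 := by
    rw [map_sub, map_inclusion hF, sub_self]
  have h1 := h.2 (alternating L ++ [(0, n)]) (by simp) (isChain_alternating L n [] (by simp)) (by
    intro q hq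
    rcases List.mem_append.1 hq with hq | hq
    · exact mem_alternating hLc hE hq
    · rw [List.mem_singleton.1 hq]
      exact hn)
  have h2 := h.2 (alternating L ++ [(0, n), (1, ((b - Subalgebra.inclusion hDB (F b) : B) : M))])
    (by simp) (isChain_alternating L n _ (by simp)) (by
    intro q hq
    rcases List.mem_append.1 hq with hq | hq
    · exact mem_alternating hLc hE hq
    · simp only [List.mem_cons, List.not_mem_nil, or_false] at hq
      rcases hq with rfl | rfl
      · exact hn
      · exact ⟨SetLike.coe_mem (b - Subalgebra.inclusion hDB (F b)),
          (congrArg F (hE.map_coe _)).trans hb0⟩)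
  rw [List.map_append, List.prod_append, prod_alternating] at h1 h2
  simp only [List.map_cons, List.map_nil, List.prod_cons, List.prod_nil, mul_one] at h1 h2
  have h3 := (hE.comp hF).map_mul_right ((pairLetters L).prod * n) (F b)
  rw [h1, zero_mul] at h3
  have h4 : (pairLetters (L ++ [(n, b)])).prod = (pairLetters L).prod *
      (n * ((b - Subalgebra.inclusion hDB (F b) : B) : M)) +
      (pairLetters L).prod * n * (F b : M) := by
    simp only [pairLetters, List.map_append, List.prod_append, List.map_cons, List.map_nil,
      List.prod_singleton, mul_assoc, ← mul_add, Subalgebra.coe_sub, Subalgebra.coe_inclusion,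
      sub_add_cancel]
  change (F ∘ₗ E) _ = 0
  rw [h4, map_add, h2, h3, add_zero]

/-- Letters from `N` are paired with the letters from `B` behind them. A word ending in `N` gets the
last coefficient `1`, which need not be centred. -/
theorem exists_centredWord (l : List (Fin 2 × M))
    (hchain : l.IsChain fun p q => p.1 ≠ q.1)
    (hmem : ∀ p ∈ l, p.2 ∈ (![N, B] : Fin 2 → Subalgebra ℂ M) p.1 ∧ (F ∘ₗ E) p.2 = 0)
    (hE : IsCondExp B.val E) (hhead : ∃ m l', l = (0, m) :: l') :
    ∃ L : List (M × B), IsCentredWord E F N L ∧ (pairLetters L).prod = (l.map Prod.snd).prod := by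
  induction hn : l.length using Nat.strong_induction_on generalizing l with
  | _ k ih =>
    obtain ⟨m, l, rfl⟩ := hhead
    rw [List.forall_mem_cons] at hmem
    have hm : m ∈ N ∧ F (E m) = 0 := hmem.1
    rcases l with _ | ⟨⟨j, b⟩, l⟩
    · exact ⟨[(m, 1)], ⟨by simp, List.forall_mem_singleton.2 hm, by simp⟩, by simp [pairLetters]⟩
    rw [List.isChain_cons_cons] at hchain
    rw [List.forall_mem_cons] at hmem
    obtain rfl : j = 1 := Fin.eq_one_of_ne_zero j hchain.1.symm
    have hb : b ∈ B := hmem.2.1.1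
    have hFb : F ⟨b, hb⟩ = 0 := by
      have : F (E ((⟨b, hb⟩ : B) : M)) = 0 := hmem.2.1.2
      rwa [hE.map_coe] at this
    rcases l with _ | ⟨⟨j, n⟩, l⟩
    · exact ⟨[(m, ⟨b, hb⟩)], ⟨by simp, List.forall_mem_singleton.2 hm, by simp⟩,
        by simp [pairLetters]⟩
    have hchain' := hchain.2
    rw [List.isChain_cons_cons] at hchain'
    obtain rfl : j = 0 := by
      by_contra hj
      exact hchain'.1 (Fin.eq_one_of_ne_zero j hj).symm
    obtain ⟨L, hL, hprod⟩ := ih _ (by simp at hn ⊢; omega) _ hchain'.2 hmem.2.2 ⟨n, l, rfl⟩ rfl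
    refine ⟨(m, ⟨b, hb⟩) :: L, ⟨by simp, List.forall_mem_cons.2 ⟨hm, hL.fst⟩, ?_⟩, ?_⟩
    · rw [List.dropLast_cons_of_ne_nil hL.ne_nil]
      exact List.forall_mem_cons.2 ⟨hFb, hL.snd⟩
    · rw [pairLetters, List.map_cons, ← pairLetters, List.prod_cons, hprod]
      simp [mul_assoc]

theorem isFreeOver_iff_centredMomentsVanish (hE : IsCondExp B.val E)
    (hF : IsCondExp (Subalgebra.inclusion hDB) F)
    (hfaithful : ∀ b₁ : B, (∀ b₂ : B, F (b₁ * b₂) = 0) → b₁ = 0) (hDN : D ≤ N) :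
    IsFreeOver (F ∘ₗ E) ![N, B] ↔ CentredMomentsVanish E F N := by
  refine ⟨fun h L hL => hfaithful _ fun b₂ => ?_, fun h => ?_⟩
  -- The last coefficient is arbitrary, so it can absorb the test element `b₂` and the word stays
  -- centred.
  · obtain ⟨L, ⟨n, b⟩, rfl⟩ : ∃ l a, L = l ++ [a] := by
      simpa [List.concat_eq_append] using (List.eq_nil_or_concat L).resolve_left hL.ne_nil
    have hL' : IsCentredWord E F N (L ++ [(n, b * b₂)]) := by
      refine ⟨by simp, fun p hp => ?_, fun p hp => hL.snd p (by simpa using hp)⟩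
      rcases List.mem_append.1 hp with hp | hp
      · exact hL.fst p (by simp [hp])
      · rw [List.mem_singleton.1 hp]
        exact hL.fst (n, b) (by simp)
    have := h.map_centredWord hE hF hL'
    rw [← hE.map_mul_right, ← this]
    simp [pairLetters, mul_assoc]
  · rw [isFreeOver_iff_list]
    refine ⟨fun j => ?_, fun l hl hchain hmem => ?_⟩
    · fin_cases j
      · exact hDN
      · exact hDB
    · have hzero : ∀ l : List (Fin 2 × M), l.IsChain (fun p q => p.1 ≠ q.1) →
          (∀ p ∈ l, p.2 ∈ (![N, B] : Fin 2 → Subalgebra ℂ M) p.1 ∧ (F ∘ₗ E) p.2 = 0) →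
          (∃ m l', l = (0, m) :: l') → E (l.map Prod.snd).prod = 0 := by
        intro l hchain hmem hhead
        obtain ⟨L, hL, hprod⟩ := exists_centredWord l hchain hmem hE hhead
        rw [← hprod, h L hL]
      obtain ⟨⟨j, m⟩, l, rfl⟩ := List.exists_cons_of_ne_nil hl
      by_cases hj : j = 0
      · subst hj
        rw [LinearMap.comp_apply, hzero _ hchain hmem ⟨m, l, rfl⟩, map_zero]
      -- A leading letter from `B` is pulled out of `E`, which leaves a word starting in `N`.
      · obtain rfl : j = 1 := Fin.eq_one_of_ne_zero j hj
        rw [List.forall_mem_cons] at hmem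
        rcases l with _ | ⟨⟨j, n⟩, l⟩
        · simpa using hmem.1.2
        rw [List.isChain_cons_cons] at hchain
        obtain rfl : j = 0 := by
          by_contra hj
          exact hchain.1 (Fin.eq_one_of_ne_zero j hj).symm
        have hm : m ∈ B := hmem.1.1
        have h0 := hzero _ hchain.2 hmem.2 ⟨n, l, rfl⟩
        have h1 := hE.map_mul_left ⟨m, hm⟩ (((0, n) :: l).map Prod.snd).prod
        rw [h0, mul_zero] at h1
        rw [LinearMap.comp_apply, List.map_cons, List.prod_cons, h1, map_zero]

theorem isFreeOver_iff_scalarCumulants (hE : IsCondExp B.val E)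
    (hF : IsCondExp (Subalgebra.inclusion hDB) F)
    (hfaithful : ∀ b₁ : B, (∀ b₂ : B, F (b₁ * b₂) = 0) → b₁ = 0) (hDN : D ≤ N) :
    IsFreeOver (F ∘ₗ E) ![N, B] ↔ ScalarCumulants hDB E F N := by
  rw [isFreeOver_iff_centredMomentsVanish hE hF hfaithful hDN]
  exact ⟨fun h => h.scalarCumulants hE hF hDN, fun h => h.centredMomentsVanish hE hF⟩

/-! ### Conditions (b) and (c) as scalar cumulants -/

theorem scalarCumulants_iff_forall (hE : IsCondExp B.val E)
    (hF : IsCondExp (Subalgebra.inclusion hDB) F) {T : Set M} :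
    ScalarCumulants hDB E F T ↔ ∀ (L : List (M × B)) (n : M), (∀ p ∈ L, p.1 ∈ T) → n ∈ T →
      (cumulantMap E (pairLetters L ++ [n]) : M) =
        F (cumulantMap E ((L.map fun p => p.1 * (F p.2 : M)) ++ [n])) := by
  constructor
  · intro h L n hL hn
    -- The two systems compared are the given coefficients (`false`) and their images under `F`
    -- (`true`), with last coefficient `1` in both.
    obtain ⟨d, hd⟩ := h ((L.map fun p =>
      (p.1, fun i => cond i (Subalgebra.inclusion hDB (F p.2)) p.2)) ++ [(n, fun _ => 1)])
      (by simp) (by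
        rw [isBalanced_append, isBalanced_cons]
        refine ⟨fun p hp => ?_, ⟨hn, fun _ _ => rfl⟩, isBalanced_nil⟩
        obtain ⟨p, hpL, rfl⟩ := List.mem_map.1 hp
        refine ⟨hL p hpL, fun i j => ?_⟩
        cases i <;> cases j <;> simp [map_inclusion hF])
    have h1 := hd false
    have h2 := hd true
    simp only [lastCoeff_concat, mul_one, letters, List.map_append, List.map_map, List.map_cons,
      List.map_nil, Subalgebra.coe_one, Function.comp_def, cond_true, cond_false,
      Subalgebra.coe_inclusion] at h1 h2
    rw [pairLetters, h1, h2, map_inclusion hF, Subalgebra.coe_inclusion]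
  · intro h L hL hb
    obtain ⟨L, q, rfl⟩ : ∃ l a, L = l ++ [a] := by
      simpa [List.concat_eq_append] using (List.eq_nil_or_concat L).resolve_left hL
    rw [isBalanced_append, isBalanced_cons] at hb
    refine ⟨F (cumulantMap E ((L.map fun p => p.1 * (F (p.2 false) : M)) ++ [q.1])),
      fun i => ?_⟩
    have h1 := h (L.map fun p => (p.1, p.2 i)) q.1 (by
      intro p hp
      obtain ⟨p, hpL, rfl⟩ := List.mem_map.1 hp
      exact (hb.1 p hpL).1) hb.2.1.1
    have h2 : (L.map fun p => (p.1, p.2 i)).map (fun p => p.1 * (F p.2 : M)) =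
        L.map fun p => p.1 * (F (p.2 false) : M) := by
      rw [List.map_map]
      refine List.map_congr_left fun p hp => ?_
      simp only [Function.comp_apply, (hb.1 p hp).2 i false]
    rw [h2] at h1
    have h3 : cumulantMap E (letters i L ++ [q.1]) = Subalgebra.inclusion hDB
        (F (cumulantMap E ((L.map fun p => p.1 * (F (p.2 false) : M)) ++ [q.1]))) := by
      refine Subtype.ext ?_
      rw [Subalgebra.coe_inclusion, ← h1]
      simp [pairLetters, letters, Function.comp_def]
    simp only [lastCoeff_concat]
    rw [← h3, ← (isAdditiveBracket_cumulantMap hE).mul_right, letters_append]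
    rfl

/-- Applying the hypothesis to the coefficients `F b` as well shows that the `D`-valued cumulant is
`E`'s cumulant with these coefficients; (b) follows. -/
theorem scalarCumulants_of_forall_cumulantMap (hE : IsCondExp B.val E)
    (hF : IsCondExp (Subalgebra.inclusion hDB) F) {T : Set M}
    (h : ∀ (L : List (M × B)) (n : M), (∀ p ∈ L, p.1 ∈ T) → n ∈ T →
      (cumulantMap E (pairLetters L ++ [n]) : M) =
        cumulantMap (F ∘ₗ E) ((L.map fun p => p.1 * (F p.2 : M)) ++ [n])) :
    ScalarCumulants hDB E F T := by
  rw [scalarCumulants_iff_forall hE hF]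
  intro L n hL hn
  have h1 := h (L.map fun p => (p.1, Subalgebra.inclusion hDB (F p.2))) n (by
    intro p hp
    obtain ⟨p, hpL, rfl⟩ := List.mem_map.1 hp
    exact hL p hpL) hn
  simp only [pairLetters, List.map_map, Function.comp_def, map_inclusion hF,
    Subalgebra.coe_inclusion] at h1
  have h2 : cumulantMap E ((L.map fun p => p.1 * (F p.2 : M)) ++ [n]) = Subalgebra.inclusion hDB
      (cumulantMap (F ∘ₗ E) ((L.map fun p => p.1 * (F p.2 : M)) ++ [n])) := Subtype.ext h1
  rw [h2, map_inclusion hF, h L n hL hn]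

theorem ScalarCumulants.cumulantMap_eq (hE : IsCondExp B.val E)
    (hF : IsCondExp (Subalgebra.inclusion hDB) F) (hDN : D ≤ N)
    (h : ScalarCumulants hDB E F N) (L : List (M × B)) (n : M) (hL : ∀ p ∈ L, p.1 ∈ N)
    (hn : n ∈ N) : (cumulantMap E (pairLetters L ++ [n]) : M) =
      cumulantMap (F ∘ₗ E) ((L.map fun p => p.1 * (F p.2 : M)) ++ [n]) := by
  have h1 := (scalarCumulants_iff_forall hE hF).1 h
  have h2 := h1 (L.map fun p => (p.1, Subalgebra.inclusion hDB (F p.2))) n (by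
    intro p hp
    obtain ⟨p, hpL, rfl⟩ := List.mem_map.1 hp
    exact hL p hpL) hn
  simp only [pairLetters, List.map_map, Function.comp_def, map_inclusion hF,
    Subalgebra.coe_inclusion] at h2
  rw [h1 L n hL hn, ← h2]
  refine cumulantMap_eq_of_scalar hE (hE.comp hF) hDN (fun m hm => ?_) _ (by simp) (fun m hm => ?_)
  · have := h.coe_eq hE hF hm
    rw [this, Subalgebra.coe_inclusion]
    rfl
  · rcases List.mem_append.1 hm with hm | hm
    · obtain ⟨p, hp, rfl⟩ := List.mem_map.1 hm
      exact N.mul_mem (hL p hp) (hDN (F _).2)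
    · rwa [List.mem_singleton.1 hm]

theorem forall_list_iff_forall_ofFn {J : Type*} (Z : J → M) (P : List (M × B) → M → Prop) :
    (∀ (L : List (M × B)) (n : M), (∀ p ∈ L, p.1 ∈ Set.range Z) → n ∈ Set.range Z → P L n) ↔
      ∀ (p : ℕ) (i : Fin (p + 1) → J) (b : Fin p → B),
        P (List.ofFn fun j : Fin p => (Z (i j.castSucc), b j)) (Z (i (Fin.last p))) := by
  constructor
  · intro h p i b
    refine h _ _ (fun q hq => ?_) ⟨_, rfl⟩
    obtain ⟨r, rfl⟩ := List.mem_ofFn.1 hq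
    exact ⟨_, rfl⟩
  · rintro h L _ hL ⟨j, rfl⟩
    obtain ⟨p, f, rfl⟩ : ∃ (p : ℕ) (f : Fin p → M × B), L = List.ofFn f :=
      ⟨_, L.get, (List.ofFn_get L).symm⟩
    choose i hi using fun r => hL (f r) (List.mem_ofFn.2 ⟨r, rfl⟩)
    have := h p (Fin.snoc (α := fun _ => J) i j) (fun r => (f r).2)
    simpa [hi] using this

theorem scalarCumulants_range_iff (hE : IsCondExp B.val E)
    (hF : IsCondExp (Subalgebra.inclusion hDB) F) {J : Type*} (Z : J → M) :
    ScalarCumulants hDB E F (Set.range Z) ↔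
      ∀ (p : ℕ) (i : Fin (p + 1) → J) (b : Fin p → B),
        (cumulantSeries E Z i b : M) =
          F (cumulantSeries E Z i fun j => Subalgebra.inclusion hDB (F (b j))) := by
  rw [scalarCumulants_iff_forall hE hF, forall_list_iff_forall_ofFn Z]
  simp only [cumulantSeries, pairLetters, List.map_ofFn, Function.comp_def,
    Subalgebra.coe_inclusion]

theorem scalarCumulants_range_iff_comp (hE : IsCondExp B.val E)
    (hF : IsCondExp (Subalgebra.inclusion hDB) F) {J : Type*} (Z : J → M) :
    ScalarCumulants hDB E F (Set.range Z) ↔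
      ∀ (p : ℕ) (i : Fin (p + 1) → J) (b : Fin p → B),
        (cumulantSeries E Z i b : M) = cumulantSeries (F ∘ₗ E) Z i fun j => F (b j) := by
  have h := forall_list_iff_forall_ofFn (B := B) Z fun L n =>
    (cumulantMap E (pairLetters L ++ [n]) : M) =
      cumulantMap (F ∘ₗ E) ((L.map fun p => p.1 * (F p.2 : M)) ++ [n])
  simp only [cumulantSeries, pairLetters, List.map_ofFn, Function.comp_def] at h ⊢
  rw [← h]
  constructor
  · intro hS L n hL hn
    -- Comparing the cumulants of `E` and `F ∘ E` needs a subalgebra containing `D` on which the two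
    -- agree, hence the passage to the generated algebra.
    have hsub : Set.range Z ⊆ Algebra.adjoin ℂ ((D : Set M) ∪ Set.range Z) :=
      fun x hx => Algebra.subset_adjoin (Or.inr hx)
    exact (hS.adjoin hE hF).cumulantMap_eq hE hF
      (fun d hd => Algebra.subset_adjoin (Or.inl hd)) L n (fun p hp => hsub (hL p hp)) (hsub hn)
  · exact scalarCumulants_of_forall_cumulantMap hE hF

theorem isFreeOver_adjoin_iff (hE : IsCondExp B.val E)
    (hF : IsCondExp (Subalgebra.inclusion hDB) F)
    (hfaithful : ∀ b₁ : B, (∀ b₂ : B, F (b₁ * b₂) = 0) → b₁ = 0) {J : Type*} (Z : J → M) :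
    IsFreeOver (F ∘ₗ E) ![Algebra.adjoin ℂ ((D : Set M) ∪ Set.range Z), B] ↔
      ScalarCumulants hDB E F (Set.range Z) := by
  have hD : D ≤ Algebra.adjoin ℂ ((D : Set M) ∪ Set.range Z) :=
    fun d hd => Algebra.subset_adjoin (Or.inl hd)
  rw [isFreeOver_iff_scalarCumulants hE hF hfaithful hD]
  exact ⟨fun h => h.mono fun x hx => Algebra.subset_adjoin (Or.inr hx), fun h => h.adjoin hE hF⟩

end MainTheorem

theorem mainTheorem1 {M : Type*} [Ring M] [Algebra ℂ M]
    (B D : Subalgebra ℂ M) (hDB : D ≤ B)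
    (E : M →ₗ[ℂ] B) (hE : IsCondExp B.val E)
    (F : B →ₗ[ℂ] D) (hF : IsCondExp (Subalgebra.inclusion hDB) F)
    (hfaithful : ∀ b₁ : B, (∀ b₂ : B, F (b₁ * b₂) = 0) → b₁ = 0) :
    (∀ (n : ℕ) (X : Fin n → M),
      (IsFreeOver (F ∘ₗ E) ![Algebra.adjoin ℂ ((D : Set M) ∪ Set.range X), B] ↔
        ∀ (p : ℕ) (i : Fin (p + 1) → Fin n) (b : Fin p → B),
          (cumulantSeries E X i b : M) =
            F (cumulantSeries E X i fun j => Subalgebra.inclusion hDB (F (b j)))) ∧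
      (IsFreeOver (F ∘ₗ E) ![Algebra.adjoin ℂ ((D : Set M) ∪ Set.range X), B] ↔
        ∀ (p : ℕ) (i : Fin (p + 1) → Fin n) (b : Fin p → B),
          (cumulantSeries E X i b : M) = cumulantSeries (F ∘ₗ E) X i fun j => F (b j))) ∧
    (∀ N : Subalgebra ℂ M, D ≤ N →
      (IsFreeOver (F ∘ₗ E) ![N, B] ↔
        ∀ (p : ℕ) (m : Fin (p + 1) → N) (b : Fin p → B),
          (cumulantMap E
              (List.ofFn (fun j : Fin p => (m j.castSucc : M) * (b j : M)) ++
                [(m (Fin.last p) : M)]) : M) =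
            F (cumulantMap E
              (List.ofFn (fun j : Fin p => (m j.castSucc : M) * (F (b j) : M)) ++
                [(m (Fin.last p) : M)])))) := by
  refine ⟨fun n X => ⟨?_, ?_⟩, fun N hDN => ?_⟩
  · rw [isFreeOver_adjoin_iff hE hF hfaithful, scalarCumulants_range_iff hE hF]
  · rw [isFreeOver_adjoin_iff hE hF hfaithful, scalarCumulants_range_iff_comp hE hF]
  · have h := scalarCumulants_range_iff hE hF (fun m : N => (m : M))
    rw [Subtype.range_coe_subtype] at h
    rw [isFreeOver_iff_scalarCumulants hE hF hfaithful hDN]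
    exact h
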